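/- **Setting.** An MDP with finite state set $\mathcal S$ and finite action set $\mathcal A$ is given by a transition-reward kernel $\mathcal Q:\mathcal S\times\mathcal A\to\mathrm{Dists}(\mathcal S\times[0,1])$. For a discount factor $\gamma\in(0,1)$ and a stationary memoryless (possibly randomized) policy $\pi$, let $v^\pi(s)=\mathbb E_{\pi,s}[\sum_{t\ge0}\gamma^tR_t]$, $q^\pi(s,a)=\mathbb E_{\pi,s,a}[\sum_{t\ge0}\gamma^tR_t]$ and $v^\star=\sup_\pi v^\pi$. For a feature map $\phi:\mathcal S\times\mathcal A\to\mathbb R^d$ with $\|\phi(s,a)\|_2\le L$ for all $(s,a)$, the *uniform policy value-function approximation error* with parameter radius $B$ is $\sup_\pi\inf_{\|\theta\|_2\le B}\sup_{(s,a)}|q^\pi(s,a)-\langle\phi(s,a),\theta\rangle|$, where $\pi$ ranges over the deterministic stationary memoryless policies. The MDP is *linear* with respect to $\phi$ (with radii $L,B$) if there are $\theta_r\in\mathbb R^d$ with $\|\theta_r\|_2\le B$ and $\psi:\mathcal S\to\mathbb R^d$ with $\sum_s\|\psi(s)\|_2\le B$ such that the expected rewards are $r(s,a)=\langle\phi(s,a),\theta_r\rangle$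 and the transition probabilities are $P(s'|s,a)=\langle\phi(s,a),\psi(s')\rangle$. A *random-access planner* is a randomized procedure that, given the record of its previous queries and the answers to them, either queries an arbitrary pair $(s,a)$, which the simulator answers by an independent sample from $\mathcal Q(s,a)$, or halts and outputs a stationary memoryless policy; $\tau$ denotes its number of queries. It is *$(\alpha,\delta)$-sound* on a class $\mathcal M$ of MDPs (with common $\mathcal S$, $\mathcal A$, initial state $s_0$ and feature map $\phi$, all known to the planner) if, for every $M\in\mathcal M$, it halts almost surely and its output $\pi$ satisfies $v^\star(s_0)-v^\pi(s_0)\le\alpha$ with probability at least $1-\delta$. Its *query complexity* over $\mathcal M$ is $\sup_{M\in\mathcal M}\mathbb E_M[\tau]$. **Theorem.** There is an absolute constant $c>0$ such that the following hold for all $\gamma\in[\frac7{12},1)$, $\delta\in(0,0.08]$ and integers $d\ge3$, with $L=2$ and $B=2/(1-\gamma)$. 1. For every $\alpha\in\bigl(0,\frac{0.05\gamma}{(1-\gamma)(1+\gamma)^2}\bigr)$ and every $\epsilon\ge0$ there is a class $\mathcal M$ of two-state MDPs with a common finite non-empty action set and a common $d$-dimensional feature map, each with uniform policy value-function approximation error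 at most $\epsilon$, such that every random-access planner that is $(\alpha,\delta)$-sound on $\mathcal M$ has query complexity over $\mathcal M$ at least $$\max\left(\exp\Bigl(\frac{c\,d\,\epsilon^2}{\alpha^2(1-\gamma)^2}\Bigr),\ \frac{c\,d^2}{\alpha^2(1-\gamma)^3}\right).$$ 2. For every $\alpha\in\bigl(0,\frac{0.05\gamma}{(1-\gamma)(1+\gamma)^2}\bigr]$ there is a class $\mathcal M$ of two-state MDPs with a common finite non-empty action set that are linear with respect to a common $d$-dimensional feature map, each with uniform policy value-function approximation error $0$, such that every random-access planner that is $(\alpha,\delta)$-sound on $\mathcal M$ has query complexity over $\mathcal M$ at least $\dfrac{c\,d^2}{\alpha^2(1-\gamma)^3}$. -/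

import Mathlib

open MeasureTheory ProbabilityTheory
open scoped ENNReal

noncomputable section

namespace Planning

/-- A Markov decision process with state space `S` and action space `A`, given by its
transition-reward kernel: `Q (s, a)` is the joint law of the next state and of the reward, which
lies in `[0, 1]`. -/
structure MDP (S A : Type*) [MeasurableSpace S] [MeasurableSpace A] where
  Q : Kernel (S × A) (S × unitInterval)
  markov : IsMarkovKernel Q

attribute [instance] MDP.markov

/-- Stationary memoryless (randomized) policies; `π s a` is the probability of action `a` in
state `s`. The measurable structure is that of the product of the simplices. -/
abbrev Policy (S A : Type*) [Fintype A] := S → stdSimplex ℝ A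

/-- The deterministic policy that plays the action `f s` in state `s`. -/
def detPolicy {S A : Type*} [Fintype A] [DecidableEq A] (f : S → A) : Policy S A :=
  fun s => ⟨Pi.single (f s) 1, single_mem_stdSimplex ℝ (f s)⟩

section Values

variable {S A : Type*} [MeasurableSpace S] [Countable S] [MeasurableSingletonClass S]
  [Fintype A] [MeasurableSpace A]

/-- A policy as a Markov kernel from states to actions. -/
def Policy.kernel (π : Policy S A) : Kernel S A :=
  Kernel.ofFunOfCountable fun s => ∑ a, ENNReal.ofReal ((π s : A → ℝ) a) • Measure.dirac a

instance Policy.isMarkovKernel (π : Policy S A) : IsMarkovKernel π.kernel := by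
  refine ⟨fun s => ⟨?_⟩⟩
  change (∑ a, ENNReal.ofReal ((π s : A → ℝ) a) • Measure.dirac a : Measure A) Set.univ = 1
  rw [Measure.finsetSum_apply]
  simp only [Measure.smul_apply, measure_univ, smul_eq_mul, mul_one]
  have h := ENNReal.ofReal_sum_of_nonneg (s := Finset.univ) (fun a _ => (π s).2.1 a)
  rw [(π s).2.2, ENNReal.ofReal_one] at h
  exact h.symm

/-- One step of the interaction of `π` with `M` from the current state `s`: the law of
`((s, a), (s', r))` where `a ∼ π(s)` and `(s', r) ∼ Q(s, a)`. -/
def MDP.stepKernel (M : MDP S A) (π : Policy S A) : Kernel S ((S × A) × (S × unitInterval)) :=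
  (Kernel.id ×ₖ π.kernel) ⊗ₖ (Kernel.prodMkLeft S M.Q)

instance MDP.isMarkovKernel_stepKernel (M : MDP S A) (π : Policy S A) :
    IsMarkovKernel (M.stepKernel π) := by
  unfold MDP.stepKernel; infer_instance

/-- The transition kernels of the process `((S_n, A_n), (S_{n+1}, R_n))`: the step at time `n + 1`
starts at the state reached by the step at time `n`. -/
def MDP.transition (M : MDP S A) (π : Policy S A) (n : ℕ) :
    Kernel (Finset.Iic n → (S × A) × (S × unitInterval)) ((S × A) × (S × unitInterval)) :=
  (M.stepKernel π).comap (fun h => (h ⟨n, Finset.mem_Iic.2 le_rfl⟩).2.1) (by fun_prop)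

instance MDP.isMarkovKernel_transition (M : MDP S A) (π : Policy S A) (n : ℕ) :
    IsMarkovKernel (M.transition π n) := by
  unfold MDP.transition; infer_instance

/-- The law of the trajectory `((S_n, A_n), (S_{n+1}, R_n))_{n ≥ 0}` with `S_0 = s` in which all
actions, including `A_0`, follow `π`. -/
def MDP.trajV (M : MDP S A) (π : Policy S A) (s : S) :
    Measure (ℕ → (S × A) × (S × unitInterval)) :=
  Kernel.trajMeasure (X := fun _ => (S × A) × (S × unitInterval)) (M.stepKernel π s)
    (M.transition π)

/-- The law of the trajectory with `S_0 = s` and `A_0 = a` in which the later actions follow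
`π`. -/
def MDP.trajQ (M : MDP S A) (π : Policy S A) (s : S) (a : A) :
    Measure (ℕ → (S × A) × (S × unitInterval)) :=
  Kernel.trajMeasure (X := fun _ => (S × A) × (S × unitInterval))
    ((Measure.dirac (s, a)).prod (M.Q (s, a))) (M.transition π)

/-- The discounted return `∑ γ ^ t * R_t` of a trajectory. -/
def discountedReturn (γ : ℝ) (ω : ℕ → (S × A) × (S × unitInterval)) : ℝ :=
  ∑' t, γ ^ t * ((ω t).2.2 : ℝ)

/-- The state-value function `v^π`. -/
def MDP.v (M : MDP S A) (γ : ℝ) (π : Policy S A) (s : S) : ℝ :=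
  ∫ ω, discountedReturn γ ω ∂(M.trajV π s)

/-- The action-value function `q^π`. -/
def MDP.q (M : MDP S A) (γ : ℝ) (π : Policy S A) (s : S) (a : A) : ℝ :=
  ∫ ω, discountedReturn γ ω ∂(M.trajQ π s a)

/-- The optimal state-value function `v^⋆`. -/
def MDP.vStar (M : MDP S A) (γ : ℝ) (s : S) : ℝ :=
  ⨆ π : Policy S A, M.v γ π s

/-- The uniform policy value-function approximation error induced by the feature map `φ` with
parameters in the centered ball of radius `B`:
`sup_π inf_{‖θ‖ ≤ B} sup_{(s,a)} |q^π(s,a) - ⟨φ(s,a), θ⟩|`, where `π` ranges over the deterministic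
stationary memoryless policies. -/
def MDP.approxError [DecidableEq A] (M : MDP S A) (γ : ℝ) {d : ℕ}
    (φ : S → A → EuclideanSpace ℝ (Fin d)) (B : ℝ) : ℝ≥0∞ :=
  ⨆ f : S → A, ⨅ θ ∈ Metric.closedBall (0 : EuclideanSpace ℝ (Fin d)) B, ⨆ s : S, ⨆ a : A,
    ENNReal.ofReal |M.q γ (detPolicy f) s a - inner ℝ (φ s a) θ|

/-- The expected reward `r(s, a)`. -/
def MDP.reward (M : MDP S A) (s : S) (a : A) : ℝ :=
  ∫ x, (x.2 : ℝ) ∂(M.Q (s, a))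

/-- The transition probability `P(s' | s, a)`. -/
def MDP.prob (M : MDP S A) (s : S) (a : A) (s' : S) : ℝ :=
  (M.Q (s, a)).real {x | x.1 = s'}

/-- `M` is a linear MDP with respect to the feature map `φ`, with feature norms bounded by `L` and
parameter norms bounded by `B`. -/
def MDP.IsLinear (M : MDP S A) {d : ℕ} (φ : S → A → EuclideanSpace ℝ (Fin d)) (L B : ℝ) : Prop :=
  (∀ s a, ‖φ s a‖ ≤ L) ∧
  ∃ (ψ : S → EuclideanSpace ℝ (Fin d)) (θ : EuclideanSpace ℝ (Fin d)),
    ‖θ‖ ≤ B ∧ (Summable fun s => ‖ψ s‖) ∧ ∑' s, ‖ψ s‖ ≤ B ∧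
    (∀ s a, M.reward s a = inner ℝ (φ s a) θ) ∧
    (∀ s a s', M.prob s a s' = inner ℝ (φ s a) (ψ s'))

end Values

section Planners

variable (S A : Type*) [MeasurableSpace S] [Fintype A] [MeasurableSpace A]

/-- The record of `n` simulator queries: each entry is `((S_t, A_t), (S'_t, R_t))`. -/
abbrev History (n : ℕ) := Fin n → (S × A) × (S × unitInterval)

/-- A randomized random-access planner: as a (random) function of the record of the `n` queries
issued so far it either issues a query for an arbitrary state-action pair (`Sum.inl`), or halts and
outputs a stationary memoryless policy (`Sum.inr`). -/
structure Planner where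
  decide : ∀ n, Kernel (History S A n) ((S × A) ⊕ Policy S A)
  markov : ∀ n, IsMarkovKernel (decide n)

attribute [instance] Planner.markov

variable {S A}

/-- The part of the planner's decision in which it issues a query (a sub-Markov kernel). -/
def Planner.query (p : Planner S A) (n : ℕ) : Kernel (History S A n) (S × A) :=
  (p.decide n).comapRight (f := Sum.inl) ⟨Sum.inl_injective, measurable_inl, fun _ hs => hs.inl_image⟩

/-- The part of the planner's decision in which it halts (a sub-Markov kernel). -/
def Planner.halt (p : Planner S A) (n : ℕ) : Kernel (History S A n) (Policy S A) :=
  (p.decide n).comapRight (f := Sum.inr) ⟨Sum.inr_injective, measurable_inr, fun _ hs => hs.inr_image⟩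

/-- The law of the record of the first `n` queries of `p` on a simulator of `M`, restricted to the
event that at least `n` queries are issued. The simulator answers a query `(s, a)` by an independent
sample from `Q (s, a)`. -/
def Planner.historyLaw (p : Planner S A) (M : MDP S A) : ∀ n, Measure (History S A n)
  | 0 => Measure.dirac Fin.elim0
  | n + 1 =>
    ((p.historyLaw M n ⊗ₘ p.query n) ⊗ₘ (Kernel.prodMkLeft (History S A n) M.Q)).map
      fun x => Fin.snoc (α := fun _ => (S × A) × (S × unitInterval)) x.1.1 (x.1.2, x.2)

variable (S A) in
/-- The outcome of a halting run: the number `τ` of queries, their record, and the output `π_τ`. -/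
abbrev Outcome := Σ n : ℕ, History S A n × Policy S A

/-- The law of the outcome of a run of `p` on a simulator of `M`, restricted to the event that `p`
halts; its total mass is the probability of halting. -/
def Planner.runLaw (p : Planner S A) (M : MDP S A) : Measure (Outcome S A) :=
  Measure.sum fun n => (p.historyLaw M n ⊗ₘ p.halt n).map (Sigma.mk n)

/-- The expected number of queries (with `τ = ∞` if the planner does not halt). -/
def Planner.expectedQueries (p : Planner S A) (M : MDP S A) : ℝ≥0∞ :=
  ∫⁻ x, (x.1 : ℝ≥0∞) ∂(p.runLaw M) + ⊤ * (1 - p.runLaw M Set.univ)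

/-- The query complexity of a planner over a class of MDPs. -/
def Planner.queryComplexity (p : Planner S A) (𝓜 : Set (MDP S A)) : ℝ≥0∞ :=
  ⨆ M ∈ 𝓜, p.expectedQueries M

variable [Countable S] [MeasurableSingletonClass S]

/-- `p` is `(α, δ)`-sound for `M` with discount factor `γ` and initial state `s₀`: it halts almost
surely and its output is `α`-optimal at `s₀` with probability at least `1 - δ`. -/
def Planner.IsSoundFor (p : Planner S A) (M : MDP S A) (γ : ℝ) (s₀ : S) (α δ : ℝ) : Prop :=
  p.runLaw M Set.univ = 1 ∧
  ENNReal.ofReal (1 - δ) ≤ p.runLaw M {x | M.vStar γ s₀ - M.v γ x.2.2 s₀ ≤ α}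

/-- `p` is `(α, δ)`-sound for every member of the class `𝓜`. -/
def Planner.IsSound (p : Planner S A) (𝓜 : Set (MDP S A)) (γ : ℝ) (s₀ : S) (α δ : ℝ) : Prop :=
  ∀ M ∈ 𝓜, p.IsSoundFor M γ s₀ α δ

end Planners

end Planning

end

open MeasureTheory ProbabilityTheory
open scoped ENNReal

noncomputable section

/-! Every hard instance is a two-state chain: each step in state `0` pays `1`, and action `a` stays
there with a probability `p a` satisfying `γ * p a = 2 * γ - 1 + y a`; state `1` is absorbing with
reward `0`. The value at `0` is `1 / (2 * (1 - γ) - z)`, with `z` the mean of `y` under the policy,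
and `q` at `0` is affine in `y a` for every policy (`perturbed_v`, `perturbed_q`). So if `y` is
linear in the features up to `η`, all policies are realizable up to `η / (1 - γ)`. An `α`-optimal
policy has mean perturbation within `4 * α * (1 - γ) ^ 2` of the maximum (`sub_policyMean_lt`).

Quadratic term: actions are all sign vectors and `y a = D / m * ⟨θ, a⟩`, with hidden signs `θ` and
`D` of order `α * (1 - γ) ^ 2`. A nearly optimal policy reveals most signs of `θ`, whereas flipping
one sign moves each `y a` by at most `2 * D / m`, which costs `χ²`-divergence of order `D ^ 2 / (m ^
2 * (1 - γ))` per query. An Assouad argument (`Planner.sq_le_of_sign_test`) then forces about `m ^ 2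
/ (α ^ 2 * (1 - γ) ^ 3)` queries. These MDPs are exactly linear.

Exponential term: approximation error allows `y` to be nonzero at a single hidden action. With
exponentially many nearly orthogonal features, `D` times the feature of that action fits the spike
up to `ε * (1 - γ)`. Finding the action among `K` takes about `K` queries
(`Planner.card_le_lintegral_queries`).

For the maximum it suffices to choose the class that matches the larger term. If that term is an
exponential not exceeding `2`, a one-sign test that requires two queries is used instead. -/

namespace Planning

/-! ### Integration against the laws of planner histories and outcomes. -/

section PlannerLaws

lemma measurable_snoc {S A : Type*} [MeasurableSpace S] [MeasurableSpace A] (n : ℕ) :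
    Measurable fun x : (History S A n × (S × A)) × (S × unitInterval) =>
      (Fin.snoc (α := fun _ => (S × A) × (S × unitInterval)) x.1.1 (x.1.2, x.2) :
        History S A (n + 1)) := by
  refine measurable_pi_iff.2 fun i => ?_
  induction i using Fin.lastCases with
  | last => simp only [Fin.snoc_last]; fun_prop
  | cast i => simp only [Fin.snoc_castSucc]; fun_prop

variable {S A : Type*} [MeasurableSpace S] [Fintype A] [MeasurableSpace A]

instance Planner.isFiniteKernel_query (p : Planner S A) (n : ℕ) : IsFiniteKernel (p.query n) := by
  unfold Planner.query; infer_instance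

instance Planner.isFiniteKernel_halt (p : Planner S A) (n : ℕ) : IsFiniteKernel (p.halt n) := by
  unfold Planner.halt; infer_instance

lemma Planner.halt_add_query (p : Planner S A) (n : ℕ) (h : History S A n) :
    p.halt n h Set.univ + p.query n h Set.univ = 1 := by
  have h1 : p.halt n h Set.univ = p.decide n h (Set.range Sum.inr) := by
    rw [Planner.halt, Kernel.comapRight_apply' _ _ _ MeasurableSet.univ, Set.image_univ]
  have h2 : p.query n h Set.univ = p.decide n h (Set.range Sum.inl) := by
    rw [Planner.query, Kernel.comapRight_apply' _ _ _ MeasurableSet.univ, Set.image_univ]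
  rw [h1, h2, add_comm, ← measure_union Set.isCompl_range_inl_range_inr.disjoint
    measurableSet_range_inr, Set.range_inl_union_range_inr, measure_univ]

lemma Planner.lintegral_historyLaw_zero (p : Planner S A) (M : MDP S A)
    {f : History S A 0 → ℝ≥0∞} (hf : Measurable f) :
    ∫⁻ h, f h ∂p.historyLaw M 0 = f Fin.elim0 := by
  rw [Planner.historyLaw, lintegral_dirac' _ hf]

instance Planner.isFiniteMeasure_historyLaw (p : Planner S A) (M : MDP S A) (n : ℕ) :
    IsFiniteMeasure (p.historyLaw M n) := by
  induction n with
  | zero => unfold Planner.historyLaw; infer_instance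
  | succ n ih => unfold Planner.historyLaw; infer_instance

lemma Planner.lintegral_historyLaw_succ (p : Planner S A) (M : MDP S A) (n : ℕ)
    {f : History S A (n + 1) → ℝ≥0∞} (hf : Measurable f) :
    ∫⁻ h, f h ∂p.historyLaw M (n + 1) =
      ∫⁻ h, ∫⁻ x, ∫⁻ y, f (Fin.snoc (α := fun _ => (S × A) × (S × unitInterval)) h (x, y))
        ∂M.Q x ∂p.query n h ∂p.historyLaw M n := by
  have hs : Measurable fun x : (History S A n × (S × A)) × (S × unitInterval) =>
      f (Fin.snoc (α := fun _ => (S × A) × (S × unitInterval)) x.1.1 (x.1.2, x.2)) :=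
    hf.comp (measurable_snoc n)
  rw [Planner.historyLaw, lintegral_map hf (measurable_snoc n),
    Measure.lintegral_compProd hs, Measure.lintegral_compProd]
  · rfl
  · exact Measurable.lintegral_kernel_prod_right' hs

lemma MDP.measurable_lintegral_snoc {S A : Type*} [MeasurableSpace S] [MeasurableSpace A]
    (M : MDP S A) (n : ℕ)
    {f : History S A (n + 1) → ℝ≥0∞} (hf : Measurable f) :
    Measurable fun x : History S A n × (S × A) => ∫⁻ y,
      f (Fin.snoc (α := fun _ => (S × A) × (S × unitInterval)) x.1 (x.2, y)) ∂M.Q x.2 :=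
  Measurable.lintegral_kernel_prod_right' (κ := Kernel.prodMkLeft (History S A n) M.Q)
    (hf.comp (measurable_snoc n))

lemma Planner.measurable_lintegral_query (p : Planner S A) (M : MDP S A) (n : ℕ)
    {f : History S A (n + 1) → ℝ≥0∞} (hf : Measurable f) :
    Measurable fun h => ∫⁻ x, ∫⁻ y,
      f (Fin.snoc (α := fun _ => (S × A) × (S × unitInterval)) h (x, y))
        ∂M.Q x ∂p.query n h :=
  Measurable.lintegral_kernel_prod_right' (M.measurable_lintegral_snoc n hf)

lemma measurable_outcome_mk (n : ℕ) :
    Measurable fun x : History S A n × Policy S A => (⟨n, x⟩ : Outcome S A) :=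
  fun _ ht => (MeasurableSpace.measurableSet_iInf.1 ht) n

lemma measurable_outcome {β : Type*} [MeasurableSpace β] {F : Outcome S A → β}
    (h : ∀ n, Measurable fun x : History S A n × Policy S A => F ⟨n, x⟩) : Measurable F :=
  fun _ ht => MeasurableSpace.measurableSet_iInf.2 fun n => h n ht

lemma Planner.measurable_lintegral_halt (p : Planner S A) (n : ℕ)
    {F : Outcome S A → ℝ≥0∞} (hF : Measurable F) :
    Measurable fun h => ∫⁻ π, F ⟨n, h, π⟩ ∂p.halt n h :=
  Measurable.lintegral_kernel_prod_right' (hF.comp (measurable_outcome_mk n))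

lemma Planner.lintegral_runLaw (p : Planner S A) (M : MDP S A)
    {F : Outcome S A → ℝ≥0∞} (hF : Measurable F) :
    ∫⁻ x, F x ∂p.runLaw M =
      ∑' n, ∫⁻ h, ∫⁻ π, F ⟨n, h, π⟩ ∂p.halt n h ∂p.historyLaw M n := by
  rw [Planner.runLaw, lintegral_sum_measure]
  refine tsum_congr fun n => ?_
  rw [lintegral_map hF (measurable_outcome_mk n),
    Measure.lintegral_compProd (f := fun x => F ⟨n, x⟩) (hF.comp (measurable_outcome_mk n))]

/-- Two MDPs that differ only on a set `Z` of pairs give the same law to the histories that avoid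
`Z`. -/
lemma Planner.lintegral_historyLaw_congr (p : Planner S A) {M M' : MDP S A} {Z : Set (S × A)}
    (hQ : ∀ x ∉ Z, M.Q x = M'.Q x) (n : ℕ) {f : History S A n → ℝ≥0∞} (hf : Measurable f)
    (hZ : ∀ h i, (h i).1 ∈ Z → f h = 0) :
    ∫⁻ h, f h ∂p.historyLaw M n = ∫⁻ h, f h ∂p.historyLaw M' n := by
  induction n with
  | zero => rw [p.lintegral_historyLaw_zero M hf, p.lintegral_historyLaw_zero M' hf]
  | succ n ih =>
    rw [p.lintegral_historyLaw_succ M n hf, p.lintegral_historyLaw_succ M' n hf,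
      ih (p.measurable_lintegral_query M n hf)]
    · refine lintegral_congr fun h => lintegral_congr fun x => ?_
      -- A query in `Z` kills the integrand; any other query is answered identically by both MDPs.
      by_cases hx : x ∈ Z
      · have : ∀ y, f (Fin.snoc (α := fun _ => (S × A) × (S × unitInterval)) h (x, y)) = 0 :=
          fun y => hZ _ (Fin.last n) (by simpa using hx)
        simp [this]
      · rw [hQ x hx]
    · intro h i hi
      have : ∀ x y, f (Fin.snoc (α := fun _ => (S × A) × (S × unitInterval)) h (x, y)) = 0 :=
        fun x y => hZ _ i.castSucc (by simpa using hi)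
      simp [this]

lemma Planner.lintegral_runLaw_congr (p : Planner S A) {M M' : MDP S A} {Z : Set (S × A)}
    (hQ : ∀ x ∉ Z, M.Q x = M'.Q x) {F : Outcome S A → ℝ≥0∞} (hF : Measurable F)
    (hZ : ∀ x i, (x.2.1 i).1 ∈ Z → F x = 0) :
    ∫⁻ x, F x ∂p.runLaw M = ∫⁻ x, F x ∂p.runLaw M' := by
  rw [p.lintegral_runLaw M hF, p.lintegral_runLaw M' hF]
  refine tsum_congr fun n => p.lintegral_historyLaw_congr hQ n (p.measurable_lintegral_halt n hF) ?_
  intro h i hi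
  have : ∀ π, F ⟨n, h, π⟩ = 0 := fun π => hZ ⟨n, h, π⟩ i hi
  simp [this]

end PlannerLaws

/-! ### Change of measure by second moments of likelihood ratios. -/

section ChiSquare

lemma sq_lintegral_le {Ω : Type*} [MeasurableSpace Ω] {μ : Measure Ω} (hμ : μ Set.univ ≤ 1)
    {f : Ω → ℝ≥0∞} (hf : Measurable f) : (∫⁻ x, f x ∂μ) ^ 2 ≤ ∫⁻ x, f x ^ 2 ∂μ := by
  have h := ENNReal.lintegral_mul_le_Lp_mul_Lq μ Real.HolderConjugate.two_two hf.aemeasurable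
    (aemeasurable_const (b := (1 : ℝ≥0∞)))
  simp only [Pi.mul_apply, mul_one, lintegral_const, ENNReal.rpow_two, one_pow, one_mul] at h
  have h2 : (∫⁻ x, f x ∂μ) ≤ (∫⁻ x, f x ^ 2 ∂μ) ^ (1 / 2 : ℝ) :=
    h.trans (mul_le_of_le_one_right' (ENNReal.rpow_le_one hμ (by norm_num)))
  calc (∫⁻ x, f x ∂μ) ^ 2 ≤ ((∫⁻ x, f x ^ 2 ∂μ) ^ (1 / 2 : ℝ)) ^ 2 := by gcongr
    _ = ∫⁻ x, f x ^ 2 ∂μ := by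
      rw [← ENNReal.rpow_two, ← ENNReal.rpow_mul]; norm_num

/-- Cauchy–Schwarz on the disjoint union of the two spaces. It is applied to one planner decision,
whose halting and querying parts have total mass `1`. -/
lemma sq_lintegral_add_lintegral_le {Ω Ω' : Type*} [MeasurableSpace Ω] [MeasurableSpace Ω']
    {μ : Measure Ω} {ν : Measure Ω'} (h : μ Set.univ + ν Set.univ ≤ 1)
    {f : Ω → ℝ≥0∞} {g : Ω' → ℝ≥0∞} (hf : Measurable f) (hg : Measurable g) :
    (∫⁻ x, f x ∂μ + ∫⁻ y, g y ∂ν) ^ 2 ≤ ∫⁻ x, f x ^ 2 ∂μ + ∫⁻ y, g y ^ 2 ∂ν := by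
  have hm : (μ.map Sum.inl + ν.map Sum.inr : Measure (Ω ⊕ Ω')) Set.univ ≤ 1 := by
    rwa [Measure.add_apply, Measure.map_apply measurable_inl .univ,
      Measure.map_apply measurable_inr .univ]
  have hfg : Measurable (Sum.elim f g) := measurable_fun_sum hf hg
  have key := sq_lintegral_le hm hfg
  rwa [lintegral_add_measure, lintegral_add_measure, lintegral_map hfg measurable_inl,
    lintegral_map hfg measurable_inr, lintegral_map (hfg.pow_const 2) measurable_inl,
    lintegral_map (hfg.pow_const 2) measurable_inr] at key

variable {S A : Type*} [MeasurableSpace S] [Fintype A] [MeasurableSpace A]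

/-- If all simulator answers have second moment of the likelihood ratio at most `C`, then so have,
up to the power `N`, the runs with at most `N` queries. -/
lemma Planner.sq_sum_lintegral_le (p : Planner S A) {M M' : MDP S A} {C : ℝ≥0∞} (hC : 1 ≤ C)
    (hQ : ∀ x, ∀ f : S × unitInterval → ℝ≥0∞, Measurable f →
      (∫⁻ y, f y ∂M.Q x) ^ 2 ≤ C * ∫⁻ y, f y ^ 2 ∂M'.Q x)
    {F : Outcome S A → ℝ≥0∞} (hF : Measurable F) (N : ℕ)
    {g : History S A N → ℝ≥0∞} (hg : Measurable g) :
    (∑ n ∈ Finset.range N, ∫⁻ h, ∫⁻ π, F ⟨n, h, π⟩ ∂p.halt n h ∂p.historyLaw M n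
        + ∫⁻ h, g h ∂p.historyLaw M N) ^ 2 ≤
      C ^ N * (∑ n ∈ Finset.range N, ∫⁻ h, ∫⁻ π, F ⟨n, h, π⟩ ^ 2 ∂p.halt n h ∂p.historyLaw M' n
        + ∫⁻ h, g h ^ 2 ∂p.historyLaw M' N) := by
  induction N with
  | zero =>
    simp [p.lintegral_historyLaw_zero M hg, p.lintegral_historyLaw_zero M' (hg.pow_const 2)]
  | succ N ih =>
    have hm1 := p.measurable_lintegral_halt N hF
    have hm2 := p.measurable_lintegral_query M N hg
    have hm1' := p.measurable_lintegral_halt N (hF.pow_const 2)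
    have hm2' := p.measurable_lintegral_query M' N (hg.pow_const 2)
    -- The arbitrary terminal function `g` makes the induction work: one more decision, either
    -- halting with payoff `F` or querying and continuing with `g`, is folded into a new terminal
    -- function of the shorter history.
    have key := ih (hm1.add hm2)
    simp only [Pi.add_apply] at key
    rw [Finset.sum_range_succ, Finset.sum_range_succ, p.lintegral_historyLaw_succ M N hg,
      p.lintegral_historyLaw_succ M' N (hg.pow_const 2), add_assoc, ← lintegral_add_left hm1]
    refine key.trans ?_
    rw [pow_succ, mul_assoc, add_assoc, ← lintegral_add_left hm1', mul_add C]
    gcongr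
    · exact le_mul_of_one_le_left zero_le hC
    · rw [← lintegral_const_mul C (by fun_prop)]
      refine lintegral_mono fun h => ?_
      have hs := (M.measurable_lintegral_snoc N hg).comp (measurable_prodMk_left (x := h))
      refine (sq_lintegral_add_lintegral_le (p.halt_add_query N h).le
        (hF.comp ((measurable_outcome_mk N).comp measurable_prodMk_left)) hs).trans ?_
      simp only [mul_add]
      refine add_le_add (le_mul_of_one_le_left zero_le hC) ?_
      exact (lintegral_mono fun x => hQ x _
        (hg.comp ((measurable_snoc N).comp (measurable_prodMk_left (x := (h, x)))))).trans_eq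
        (lintegral_const_mul C ((M'.measurable_lintegral_snoc N (hg.pow_const 2)).comp
          (measurable_prodMk_left (x := h))))

/-- The terminal function at time `N` is the integral over halting at that time, so runs with
exactly `N` queries are included at the price of only `C ^ N`. The hypothesis on answers is the
bound `C` on the second moment of the likelihood ratio, in a dual form that needs no densities. -/
lemma Planner.sq_runLaw_le (p : Planner S A) {M M' : MDP S A} {C : ℝ≥0∞} (hC : 1 ≤ C)
    (hQ : ∀ x, ∀ f : S × unitInterval → ℝ≥0∞, Measurable f →
      (∫⁻ y, f y ∂M.Q x) ^ 2 ≤ C * ∫⁻ y, f y ^ 2 ∂M'.Q x)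
    (N : ℕ) {E : Set (Outcome S A)} (hE : MeasurableSet E) :
    p.runLaw M (E ∩ {x | x.1 ≤ N}) ^ 2 ≤ C ^ N * p.runLaw M' E := by
  have hN : MeasurableSet {x : Outcome S A | x.1 ≤ N} :=
    measurableSet_setOfPred.2 (measurable_outcome fun n =>
      (measurable_const : Measurable fun _ => n ≤ N))
  have hF : Measurable (E.indicator (1 : Outcome S A → ℝ≥0∞)) := measurable_one.indicator hE
  have hF' : Measurable ((E ∩ {x | x.1 ≤ N}).indicator (1 : Outcome S A → ℝ≥0∞)) :=
    measurable_one.indicator (hE.inter hN)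
  have hsq : ∀ x, E.indicator (1 : Outcome S A → ℝ≥0∞) x ^ 2 = E.indicator 1 x := fun x => by
    by_cases hx : x ∈ E <;> simp [hx]
  have h1 : p.runLaw M (E ∩ {x | x.1 ≤ N}) = ∑ n ∈ Finset.range (N + 1),
      ∫⁻ h, ∫⁻ π, E.indicator 1 ⟨n, h, π⟩ ∂p.halt n h ∂p.historyLaw M n := by
    rw [← lintegral_indicator_one (hE.inter hN), p.lintegral_runLaw M hF', tsum_eq_sum]
    · refine Finset.sum_congr rfl fun n hn => lintegral_congr fun h => lintegral_congr fun π => ?_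
      have : n ≤ N := by simpa [Nat.lt_succ_iff] using hn
      by_cases hx : (⟨n, h, π⟩ : Outcome S A) ∈ E <;> simp [hx, this]
    · intro n hn
      have : ¬ n ≤ N := by simpa [Nat.lt_succ_iff] using hn
      simp [Set.indicator, this]
  have h2 : ∑ n ∈ Finset.range (N + 1),
      ∫⁻ h, ∫⁻ π, E.indicator 1 ⟨n, h, π⟩ ∂p.halt n h ∂p.historyLaw M' n ≤ p.runLaw M' E := by
    rw [← lintegral_indicator_one hE, p.lintegral_runLaw M' hF]
    exact ENNReal.sum_le_tsum _
  have key := p.sq_sum_lintegral_le hC hQ hF N (p.measurable_lintegral_halt N hF)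
  rw [← Finset.sum_range_succ (fun n => ∫⁻ h, ∫⁻ π, E.indicator 1 ⟨n, h, π⟩ ∂p.halt n h
    ∂p.historyLaw M n), ← h1] at key
  refine key.trans (mul_le_mul_right ?_ _)
  refine le_trans ?_ h2
  rw [Finset.sum_range_succ]
  simp only [hsq]
  gcongr with h
  refine (sq_lintegral_le (le_self_add.trans (p.halt_add_query N h).le)
    (hF.comp ((measurable_outcome_mk N).comp measurable_prodMk_left))).trans_eq ?_
  simp [Function.comp_def, hsq]

end ChiSquare

/-! ### Searching for a hidden action. -/

section Needle

variable {S A : Type*} [MeasurableSpace S] [MeasurableSingletonClass S]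
  [Fintype A] [MeasurableSpace A] [MeasurableSingletonClass A]

/-- Finding one of `|A|` actions among which the MDPs `M a` differ from `M₀` only by the answers
to the queries for `(s, a)` takes about `|A|` queries. -/
lemma Planner.card_le_lintegral_queries (p : Planner S A) (s : S) (M₀ : MDP S A) (M : A → MDP S A)
    (hQ : ∀ a, ∀ x ≠ (s, a), M₀.Q x = (M a).Q x) {δ : ℝ≥0∞}
    (G : A → Set (Policy S A)) (hG : ∀ a, MeasurableSet (G a))
    (hdisj : Pairwise fun a b => Disjoint (G a) (G b))
    (h0 : p.runLaw M₀ Set.univ = 1)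
    (hfail : ∀ a, p.runLaw (M a) {x | x.2.2 ∉ G a} ≤ δ) :
    (Fintype.card A : ℝ≥0∞) ≤ ∫⁻ x, (x.1 : ℝ≥0∞) ∂p.runLaw M₀ + 1 + Fintype.card A * δ := by
  classical
  set μ := p.runLaw M₀ with hμ
  let Nq : A → Set (Outcome S A) := fun a => {x | ∃ i, (x.2.1 i).1 = (s, a)}
  let Gs : A → Set (Outcome S A) := fun a => {x | x.2.2 ∈ G a}
  have hGs : ∀ a, MeasurableSet (Gs a) := fun a => measurableSet_setOfPred.2 <|
    measurable_outcome fun n => measurableSet_setOfPred.1 (measurable_snd (hG a))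
  have hNq : ∀ a, MeasurableSet (Nq a) := fun a => measurableSet_setOfPred.2 <|
    measurable_outcome fun n => by
      refine measurableSet_setOfPred.1 ?_
      simp only [Set.ofPred_exists]
      refine MeasurableSet.iUnion fun i => ?_
      exact (measurableSet_singleton (s, a)).preimage
        (measurable_fst.comp ((measurable_pi_apply i).comp measurable_fst))
  have hone : ∀ a, 1 ≤ μ (Nq a) + μ (Gs a) + δ := by
    intro a
    have hE : MeasurableSet ((Nq a)ᶜ ∩ (Gs a)ᶜ) := (hNq a).compl.inter (hGs a).compl
    -- Runs that never query `(s, a)` have the same law under `M₀` and `M a`, so the failure bound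
    -- for `M a` transfers to `M₀`.
    have h1 : μ ((Nq a)ᶜ ∩ (Gs a)ᶜ) ≤ δ := by
      refine le_trans (le_of_eq ?_) ((measure_mono (s := (Nq a)ᶜ ∩ (Gs a)ᶜ)
        fun x hx => hx.2).trans (hfail a))
      rw [← lintegral_indicator_one hE, ← lintegral_indicator_one hE]
      refine p.lintegral_runLaw_congr (Z := {(s, a)}) (fun x hx => hQ a x hx)
        (measurable_one.indicator hE) fun x i hi => ?_
      have : x ∈ Nq a := ⟨i, hi⟩
      simp [this]
    calc (1 : ℝ≥0∞) = μ Set.univ := h0.symm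
      _ ≤ μ (Nq a ∪ Gs a ∪ ((Nq a)ᶜ ∩ (Gs a)ᶜ)) := by
        refine measure_mono fun x _ => ?_
        by_cases hx : x ∈ Nq a <;> by_cases hy : x ∈ Gs a <;> simp [hx, hy]
      _ ≤ μ (Nq a) + μ (Gs a) + δ :=
        (measure_union_le _ _).trans (add_le_add (measure_union_le _ _) h1)
  -- A run with `x.1` queries touches at most `x.1` different actions.
  have hsumN : ∑ a, μ (Nq a) ≤ ∫⁻ x, (x.1 : ℝ≥0∞) ∂μ := by
    simp_rw [← lintegral_indicator_one (hNq _)]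
    rw [← lintegral_finsetSum _ fun a _ => measurable_one.indicator (hNq a)]
    refine lintegral_mono fun x => ?_
    have hle : (Finset.univ.filter fun a => x ∈ Nq a).card ≤ x.1 := by
      have : (Finset.univ.filter fun a => x ∈ Nq a) ⊆
          Finset.univ.image fun i : Fin x.1 => (x.2.1 i).1.2 := by
        intro a ha
        obtain ⟨i, hi⟩ := (Finset.mem_filter.1 ha).2
        exact Finset.mem_image.2 ⟨i, Finset.mem_univ i, by rw [hi]⟩
      exact (Finset.card_le_card this).trans (Finset.card_image_le.trans (by simp))
    rw [Finset.card_filter] at hle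
    simp only [Set.indicator_apply, Pi.one_apply]
    exact_mod_cast hle
  have hsumG : ∑ a, μ (Gs a) ≤ 1 := by
    have hd : Set.PairwiseDisjoint (↑(Finset.univ : Finset A)) Gs := fun a _ b _ hab =>
      Set.disjoint_left.2 fun x hx hx' => Set.disjoint_left.1 (hdisj hab) hx hx'
    rw [← measure_biUnion_finset hd fun a _ => hGs a, ← h0]
    exact measure_mono (Set.subset_univ _)
  calc (Fintype.card A : ℝ≥0∞) = ∑ _a : A, 1 := by simp
    _ ≤ ∑ a, (μ (Nq a) + μ (Gs a) + δ) := Finset.sum_le_sum fun a _ => hone a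
    _ = ∑ a, μ (Nq a) + ∑ a, μ (Gs a) + Fintype.card A * δ := by
      simp [Finset.sum_add_distrib]
    _ ≤ _ := by gcongr

end Needle

/-! ### Assouad's method for testing many signs. -/

section Assouad

variable {S A : Type*} [MeasurableSpace S] [Fintype A] [MeasurableSpace A]

/-- Testing `m` signs: if flipping the `i`-th sign changes the answers of the simulator little in
the sense of the `χ²`-divergence, then many queries are needed for guessing most signs. -/
lemma Planner.sq_le_of_sign_test (p : Planner S A) {m : ℕ} (hm : 0 < m)
    (M : (Fin m → Bool) → MDP S A) {C : ℝ} (hC : 1 ≤ C)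
    (hQ : ∀ θ i x, ∀ f : S × unitInterval → ℝ≥0∞, Measurable f →
      (∫⁻ y, f y ∂(M θ).Q x) ^ 2 ≤
        ENNReal.ofReal C * ∫⁻ y, f y ^ 2 ∂(M (Function.update θ i (!θ i))).Q x)
    (W : (Fin m → Bool) → Fin m → Set (Policy S A)) (hW : ∀ θ i, MeasurableSet (W θ i))
    (hflip : ∀ θ i, W (Function.update θ i (!θ i)) i = (W θ i)ᶜ)
    {δ ρ q N : ℝ} {n : ℕ} (hN : 0 ≤ N) (hn : N ≤ q * (n + 1)) (hpos : 0 ≤ 1 - q - δ - ρ)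
    (h1 : ∀ θ, p.runLaw (M θ) Set.univ = 1)
    (hfail : ∀ θ, p.runLaw (M θ)
      {x | ρ * m < ∑ i, (W θ i).indicator (1 : Policy S A → ℝ) x.2.2} ≤ ENNReal.ofReal δ)
    (hδ : 0 ≤ δ) (hρ : 0 ≤ ρ)
    (hτ : ∀ θ, ∫⁻ x, (x.1 : ℝ≥0∞) ∂p.runLaw (M θ) ≤ ENNReal.ofReal N) :
    (1 - q - δ - ρ) ^ 2 ≤ C ^ n * (δ + ρ) := by
  classical
  have hprob : ∀ θ, IsProbabilityMeasure (p.runLaw (M θ)) := fun θ => ⟨h1 θ⟩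
  let E : (Fin m → Bool) → Fin m → Set (Outcome S A) := fun θ i => {x | x.2.2 ∈ W θ i}
  have hE : ∀ θ i, MeasurableSet (E θ i) := fun θ i => measurableSet_setOfPred.2 <|
    measurable_outcome fun n => measurableSet_setOfPred.1 (measurable_snd (hW θ i))
  let z : (Fin m → Bool) → Fin m → ℝ := fun θ i => (p.runLaw (M θ)).real (E θ i)
  let y : (Fin m → Bool) → Fin m → ℝ := fun θ i =>
    (p.runLaw (M θ)).real ((E θ i)ᶜ ∩ {x | x.1 ≤ n})
  -- the runs with more than `n` queries
  have hlate : ∀ θ, (p.runLaw (M θ)).real {x | x.1 ≤ n}ᶜ ≤ q := by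
    intro θ
    have hmk : ((n + 1 : ℕ) : ℝ≥0∞) * p.runLaw (M θ) {x | x.1 ≤ n}ᶜ ≤ ENNReal.ofReal N := by
      refine le_trans ?_ (hτ θ)
      have : {x : Outcome S A | x.1 ≤ n}ᶜ ⊆ {x | ((n + 1 : ℕ) : ℝ≥0∞) ≤ (x.1 : ℝ≥0∞)} := by
        intro x hx
        rw [Set.mem_compl_iff, Set.mem_ofPred_eq, not_le] at hx
        rw [Set.mem_ofPred_eq]
        exact Nat.cast_le.2 hx
      refine (mul_le_mul_right (measure_mono this) _).trans ?_
      refine mul_meas_ge_le_lintegral (measurable_outcome fun k => ?_) _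
      exact (measurable_const : Measurable fun _ : History S A k × Policy S A => (k : ℝ≥0∞))
    have hr := ENNReal.toReal_mono ENNReal.ofReal_ne_top hmk
    rw [ENNReal.toReal_mul, ENNReal.toReal_natCast, ENNReal.toReal_ofReal hN] at hr
    have hr' : ((n : ℝ) + 1) * (p.runLaw (M θ)).real {x | x.1 ≤ n}ᶜ ≤ q * (n + 1) := by
      refine le_trans ?_ hn
      simpa [Measure.real] using hr
    have : (0 : ℝ) < n + 1 := by positivity
    nlinarith
  have hy : ∀ θ i, 1 - q - z θ i ≤ y θ i := by
    intro θ i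
    have hc : (p.runLaw (M θ)).real Set.univ ≤ z θ i + y θ i +
        (p.runLaw (M θ)).real {x | x.1 ≤ n}ᶜ := by
      refine le_trans ?_ ((measureReal_union_le _ _).trans
        (add_le_add_left (measureReal_union_le _ _) _))
      refine measureReal_mono fun x _ => ?_
      by_cases hx : x ∈ E θ i <;> by_cases hx' : x.1 ≤ n <;> simp [hx, hx']
    rw [probReal_univ] at hc
    linarith [hlate θ]
  -- A correct guess for `θ` is a wrong guess for the flipped vector, so being often right under one
  -- makes it often wrong under the other.
  have hpair : ∀ θ i, y θ i ^ 2 ≤ C ^ n * z (Function.update θ i (!θ i)) i := by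
    intro θ i
    have hk := p.sq_runLaw_le (ENNReal.one_le_ofReal.2 hC) (hQ θ i) n (hE θ i).compl
    have heq : E (Function.update θ i (!θ i)) i = (E θ i)ᶜ := by
      ext x; simp only [E, hflip]; rfl
    rw [← heq] at hk
    have hr := ENNReal.toReal_mono (ENNReal.mul_ne_top (by simp) (measure_ne_top _ _)) hk
    rw [ENNReal.toReal_mul, ENNReal.toReal_pow, ENNReal.toReal_pow,
      ENNReal.toReal_ofReal (by linarith)] at hr
    rw [heq] at hr
    change ((p.runLaw (M θ)).real _) ^ 2 ≤ C ^ n * ((p.runLaw (M _)).real _)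
    rw [heq]
    exact hr
  have hz : ∀ θ, ∑ i, z θ i ≤ m * (δ + ρ) := by
    intro θ
    set Bad : Set (Outcome S A) :=
      {x | ρ * m < ∑ i, (W θ i).indicator (1 : Policy S A → ℝ) x.2.2} with hBad
    have hfm : ∀ i, Measurable fun x : Outcome S A =>
        (W θ i).indicator (1 : Policy S A → ℝ) x.2.2 := fun i =>
      measurable_outcome fun k => (measurable_one.indicator (hW θ i)).comp measurable_snd
    have hBm : MeasurableSet Bad :=
      measurableSet_lt measurable_const (Finset.measurable_sum _ fun i _ => hfm i)
    have hintegral : ∀ (F : Set (Outcome S A)), MeasurableSet F →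
        Integrable (F.indicator (1 : Outcome S A → ℝ)) (p.runLaw (M θ)) := fun F hF =>
      (integrable_const (1 : ℝ)).indicator hF
    have hzi : ∀ i, z θ i = ∫ x, (E θ i).indicator (1 : Outcome S A → ℝ) x ∂p.runLaw (M θ) :=
      fun i => (integral_indicator_one (hE θ i)).symm
    simp_rw [hzi]
    rw [← integral_finsetSum _ fun i _ => hintegral _ (hE θ i)]
    have hb : (p.runLaw (M θ)).real Bad ≤ δ := by
      have := ENNReal.toReal_mono ENNReal.ofReal_ne_top (hfail θ)
      rwa [ENNReal.toReal_ofReal hδ] at this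
    calc ∫ x, ∑ i, (E θ i).indicator (1 : Outcome S A → ℝ) x ∂p.runLaw (M θ)
        ≤ ∫ x, (ρ * m + m * Bad.indicator (1 : Outcome S A → ℝ) x) ∂p.runLaw (M θ) := by
          refine integral_mono (integrable_finsetSum _ fun i _ => hintegral _ (hE θ i))
            ((integrable_const _).add ((hintegral _ hBm).const_mul _)) fun x => ?_
          have hsum : ∑ i, (E θ i).indicator (1 : Outcome S A → ℝ) x =
              ∑ i, (W θ i).indicator (1 : Policy S A → ℝ) x.2.2 := rfl
          have hle : ∑ i, (W θ i).indicator (1 : Policy S A → ℝ) x.2.2 ≤ m := by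
            calc ∑ i, (W θ i).indicator (1 : Policy S A → ℝ) x.2.2 ≤ ∑ _i : Fin m, (1 : ℝ) :=
                  Finset.sum_le_sum fun i _ => by
                    by_cases h : x.2.2 ∈ W θ i <;> simp [h]
              _ = m := by simp
          simp only [hsum]
          by_cases hx : x ∈ Bad
          · simp only [Set.indicator_of_mem hx, Pi.one_apply]
            have : 0 ≤ ρ * m := by positivity
            linarith
          · have := hx
            rw [hBad, Set.mem_ofPred_eq, not_lt] at this
            simp only [Set.indicator_of_notMem hx]
            linarith
      _ = ρ * m + m * (p.runLaw (M θ)).real Bad := by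
          have hi := integral_indicator_one (μ := p.runLaw (M θ)) hBm
          rw [integral_add (integrable_const _) ((hintegral _ hBm).const_mul _),
            integral_const_mul (m : ℝ), hi]
          simp
      _ ≤ m * (δ + ρ) := by
          have : (0 : ℝ) ≤ m := by positivity
          nlinarith
  set t := 1 - q - δ - ρ with ht
  -- Flipping a coordinate permutes the sign vectors, so both sides of `hpair` can be averaged over
  -- `θ`.
  have hinv : ∀ i, Function.Involutive fun θ : Fin m → Bool => Function.update θ i (!θ i) := by
    intro i θ; simp
  have hsum : ∀ i, ∑ θ, z (Function.update θ i (!θ i)) i = ∑ θ, z θ i := fun i =>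
    Equiv.sum_comp (Function.Involutive.toPerm _ (hinv i)) fun θ => z θ i
  have htot : ∑ θ, ∑ i, z θ i ≤ (2 : ℝ) ^ m * (m * (δ + ρ)) := by
    refine (Finset.sum_le_sum fun θ _ => hz θ).trans ?_
    simp
  have hlow : (2 : ℝ) ^ m * m * (2 * t * (1 - q) - t ^ 2) - 2 * t * ∑ θ, ∑ i, z θ i ≤
      C ^ n * ∑ θ, ∑ i, z θ i := by
    calc (2 : ℝ) ^ m * m * (2 * t * (1 - q) - t ^ 2) - 2 * t * ∑ θ, ∑ i, z θ i
        = ∑ θ : Fin m → Bool, ∑ i, (2 * t * (1 - q - z θ i) - t ^ 2) := by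
          simp only [mul_sub, Finset.sum_sub_distrib, Finset.mul_sum]
          simp
          ring
      _ ≤ ∑ θ : Fin m → Bool, ∑ i, C ^ n * z (Function.update θ i (!θ i)) i := by
          refine Finset.sum_le_sum fun θ _ => Finset.sum_le_sum fun i _ => ?_
          refine le_trans ?_ (hpair θ i)
          -- The square is replaced by its tangent at `t`, `y ^ 2 ≥ 2 * t * y - t ^ 2`; only the
          -- sums of `z`, bounded by `hz`, are then needed.
          nlinarith [hy θ i, sq_nonneg (y θ i - t)]
      _ = C ^ n * ∑ θ, ∑ i, z θ i := by
          rw [Finset.sum_comm, Finset.sum_comm (f := fun θ i => z θ i), Finset.mul_sum]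
          refine Finset.sum_congr rfl fun i _ => ?_
          rw [← Finset.mul_sum, hsum]
  have hcard : (0 : ℝ) < (2 : ℝ) ^ m * m := by positivity
  have hCn : 0 ≤ C ^ n := by positivity
  have hup : (C ^ n + 2 * t) * ∑ θ, ∑ i, z θ i ≤ (C ^ n + 2 * t) * ((2 : ℝ) ^ m * (m * (δ + ρ))) :=
    mul_le_mul_of_nonneg_left htot (by linarith)
  have : (2 : ℝ) ^ m * m * t ^ 2 ≤ (2 : ℝ) ^ m * m * (C ^ n * (δ + ρ)) := by
    have : 2 * t * (1 - q) - t ^ 2 = t ^ 2 + 2 * t * (δ + ρ) := by rw [ht]; ring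
    rw [this] at hlow
    nlinarith
  exact le_of_mul_le_mul_left this hcard

end Assouad

/-! ### Expected discounted returns of trajectories. -/

section Trajectories

lemma Policy.nonneg {S A : Type*} [Fintype A] (π : Policy S A) (s : S) (a : A) :
    0 ≤ (π s : A → ℝ) a := (π s).2.1 a

lemma Policy.sum_eq_one {S A : Type*} [Fintype A] (π : Policy S A) (s : S) :
    ∑ a, (π s : A → ℝ) a = 1 := (π s).2.2

variable {S A : Type*} [MeasurableSpace S] [Countable S] [MeasurableSingletonClass S]
  [Fintype A] [MeasurableSpace A] (M : MDP S A) (π : Policy S A)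
  (μ₀ : Measure ((S × A) × (S × unitInterval)))

/-- The law of the trajectory whose first step has law `μ₀` and whose later actions follow `π`. -/
def MDP.traj : Measure (ℕ → (S × A) × (S × unitInterval)) :=
  Kernel.trajMeasure (X := fun _ => (S × A) × (S × unitInterval)) μ₀ (M.transition π)

instance [IsProbabilityMeasure μ₀] : IsProbabilityMeasure (M.traj π μ₀) := by
  unfold MDP.traj; infer_instance

lemma MDP.lintegral_traj_zero {f : (S × A) × (S × unitInterval) → ℝ≥0∞} (hf : Measurable f) :
    ∫⁻ ω, f (ω 0) ∂M.traj π μ₀ = ∫⁻ z, f z ∂μ₀ := by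
  have h : (M.traj π μ₀).map (Preorder.frestrictLe 0) =
      μ₀.map (MeasurableEquiv.piUnique
        (fun _ : Finset.Iic (0 : ℕ) => (S × A) × (S × unitInterval))).symm := by
    rw [MDP.traj, Kernel.trajMeasure, Measure.map_comp _ _ (by fun_prop),
      Kernel.traj_map_frestrictLe, Kernel.partialTraj_self, Measure.id_comp]
  have hg : Measurable fun x : Finset.Iic (0 : ℕ) → (S × A) × (S × unitInterval) =>
      f (x ⟨0, by simp⟩) := by fun_prop
  calc ∫⁻ ω, f (ω 0) ∂M.traj π μ₀
      = ∫⁻ x, f (x ⟨0, by simp⟩) ∂(M.traj π μ₀).map (Preorder.frestrictLe 0) := by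
        rw [lintegral_map hg (by fun_prop)]; rfl
    _ = ∫⁻ z, f z ∂μ₀ := by
        rw [h, lintegral_map hg (by fun_prop)]; rfl

lemma MDP.lintegral_traj_succ [IsProbabilityMeasure μ₀]
    {f : (S × A) × (S × unitInterval) → ℝ≥0∞} (hf : Measurable f)
    (n : ℕ) :
    ∫⁻ ω, f (ω (n + 1)) ∂M.traj π μ₀ =
      ∫⁻ ω, ∫⁻ z, f z ∂M.stepKernel π (ω n).2.1 ∂M.traj π μ₀ := by
  have h := Kernel.map_frestrictLe_trajMeasure_compProd_eq_map_trajMeasure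
    (X := fun _ => (S × A) × (S × unitInterval)) (μ₀ := μ₀) (κ := M.transition π) (a := n)
  change (M.traj π μ₀).map _ ⊗ₘ _ = (M.traj π μ₀).map _ at h
  have hg : Measurable fun x : (Finset.Iic n → (S × A) × (S × unitInterval)) ×
      ((S × A) × (S × unitInterval)) => f x.2 := by fun_prop
  calc ∫⁻ ω, f (ω (n + 1)) ∂M.traj π μ₀
      = ∫⁻ x, f x.2 ∂(M.traj π μ₀).map (fun x ↦ (Preorder.frestrictLe n x, x (n + 1))) := by
        rw [lintegral_map hg (by fun_prop)]
    _ = _ := by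
        rw [← h, Measure.lintegral_compProd hg, lintegral_map _ (by fun_prop)]
        · rfl
        · exact Measurable.lintegral_kernel_prod_right' hg

lemma MDP.lintegral_stepKernel (s : S) {f : (S × A) × (S × unitInterval) → ℝ≥0∞}
    (hf : Measurable f) :
    ∫⁻ z, f z ∂M.stepKernel π s =
      ∑ a, ENNReal.ofReal ((π s : A → ℝ) a) * ∫⁻ y, f ((s, a), y) ∂M.Q (s, a) := by
  have hm : Measurable fun x : S × A => ∫⁻ y, f (x, y) ∂M.Q x :=
    Measurable.lintegral_kernel_prod_right' (κ := M.Q) hf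
  have hπ : π.kernel s = ∑ a, ENNReal.ofReal ((π s : A → ℝ) a) • Measure.dirac a := rfl
  rw [MDP.stepKernel, Kernel.lintegral_compProd _ _ _ hf, Kernel.lintegral_id_prod, hπ]
  · rw [lintegral_finsetSum_measure]
    refine Finset.sum_congr rfl fun a _ => ?_
    rw [lintegral_smul_measure, lintegral_dirac' _ (by exact hm.comp measurable_prodMk_left)]
    rfl
  · exact hm

/-- The value of the discounted return in terms of the expected rewards. -/
lemma MDP.integral_discountedReturn [IsProbabilityMeasure μ₀] {γ : ℝ} (h0 : 0 ≤ γ) (h1 : γ < 1)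
    {e : ℕ → ℝ}
    (he : ∀ t, ∫⁻ ω, ENNReal.ofReal ((ω t).2.2 : ℝ) ∂M.traj π μ₀ = ENNReal.ofReal (e t))
    (hpos : ∀ t, 0 ≤ e t) :
    ∫ ω, discountedReturn γ ω ∂M.traj π μ₀ = ∑' t, γ ^ t * e t := by
  have hmeas : ∀ t, Measurable fun ω : ℕ → (S × A) × (S × unitInterval) =>
      ((ω t).2.2 : ℝ) := fun t => by fun_prop
  have hintegral : ∀ t, ∫ ω, ((ω t).2.2 : ℝ) ∂M.traj π μ₀ = e t := fun t => by
    rw [integral_eq_lintegral_of_nonneg_ae (.of_forall fun ω => (ω t).2.2.2.1)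
      (hmeas t).aestronglyMeasurable, he, ENNReal.toReal_ofReal (hpos t)]
  have hI : ∀ t, Integrable (fun ω : ℕ → (S × A) × (S × unitInterval) => ((ω t).2.2 : ℝ))
      (M.traj π μ₀) := fun t => by
    refine Integrable.of_bound (hmeas t).aestronglyMeasurable 1 (.of_forall fun ω => ?_)
    rw [Real.norm_eq_abs, abs_of_nonneg (ω t).2.2.2.1]
    exact (ω t).2.2.2.2
  have key := hasSum_integral_of_summable_integral_norm (μ := M.traj π μ₀)
    (F := fun t ω => γ ^ t * ((ω t).2.2 : ℝ)) (fun t => (hI t).const_mul _) ?_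
  · refine key.tsum_eq.symm.trans (tsum_congr fun t => ?_)
    rw [integral_const_mul, hintegral]
  · have hle1 : ∀ t, e t ≤ 1 := fun t => by
      rw [← hintegral t]
      have := integral_mono (hI t) (integrable_const (1 : ℝ)) fun ω => (ω t).2.2.2.2
      simpa using this
    refine Summable.of_nonneg_of_le (fun t => integral_nonneg fun ω => norm_nonneg _)
      (fun t => ?_) (summable_geometric_of_lt_one h0 h1)
    have : ∀ ω : ℕ → (S × A) × (S × unitInterval), ‖γ ^ t * ((ω t).2.2 : ℝ)‖ =
        γ ^ t * ((ω t).2.2 : ℝ) := fun ω => by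
      rw [Real.norm_eq_abs, abs_of_nonneg (mul_nonneg (pow_nonneg h0 t) (ω t).2.2.2.1)]
    simp only [this, integral_const_mul, hintegral]
    exact mul_le_of_le_one_right (pow_nonneg h0 t) (hle1 t)

end Trajectories

/-! ### Closed forms for the two-state chain. -/

section TwoState

variable {k : ℕ}

/-- The MDP with reward `1` in state `0`, from which the action `a` leads to the absorbing state `1`
of reward `0` with probability `1 - p a`. -/
def twoState (p : Fin k → unitInterval) : MDP (Fin 2) (Fin k) where
  Q := Kernel.ofFunOfCountable fun x => if x.1 = 0 then
      ENNReal.ofReal (p x.2 : ℝ) • Measure.dirac (0, 1) +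
        ENNReal.ofReal (1 - (p x.2 : ℝ)) • Measure.dirac (1, 1)
    else Measure.dirac (1, 0)
  markov := by
    refine ⟨fun x => ?_⟩
    change IsProbabilityMeasure (if x.1 = 0 then _ else _)
    split_ifs
    · refine ⟨?_⟩
      have h0 := (p x.2).2.1
      have h1 := (p x.2).2.2
      simp only [Measure.add_apply, Measure.smul_apply, measure_univ, smul_eq_mul, mul_one]
      rw [← ENNReal.ofReal_add h0 (by linarith)]
      simp
    · infer_instance

lemma twoState_Q_zero (p : Fin k → unitInterval) (a : Fin k) :
    (twoState p).Q (0, a) = ENNReal.ofReal (p a : ℝ) • Measure.dirac (0, 1) +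
        ENNReal.ofReal (1 - (p a : ℝ)) • Measure.dirac (1, 1) := rfl

lemma twoState_Q_one (p : Fin k → unitInterval) (a : Fin k) :
    (twoState p).Q (1, a) = Measure.dirac (1, 0) := rfl

lemma lintegral_twoState_zero (p : Fin k → unitInterval) (a : Fin k)
    {f : Fin 2 × unitInterval → ℝ≥0∞} (hf : Measurable f) :
    ∫⁻ y, f y ∂(twoState p).Q (0, a) =
      ENNReal.ofReal (p a : ℝ) * f (0, 1) + ENNReal.ofReal (1 - (p a : ℝ)) * f (1, 1) := by
  rw [twoState_Q_zero, lintegral_add_measure, lintegral_smul_measure, lintegral_smul_measure,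
    lintegral_dirac' _ hf, lintegral_dirac' _ hf]
  rfl

lemma lintegral_twoState_one (p : Fin k → unitInterval) (a : Fin k)
    {f : Fin 2 × unitInterval → ℝ≥0∞} (hf : Measurable f) :
    ∫⁻ y, f y ∂(twoState p).Q (1, a) = f (1, 0) := by
  rw [twoState_Q_one, lintegral_dirac' _ hf]

/-- The probability of staying in state `0` under the policy `π`. -/
def stayProb (p : Fin k → unitInterval) (π : Policy (Fin 2) (Fin k)) : ℝ :=
  ∑ a, (π 0 : Fin k → ℝ) a * p a

lemma stayProb_nonneg (p : Fin k → unitInterval) (π : Policy (Fin 2) (Fin k)) :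
    0 ≤ stayProb p π :=
  Finset.sum_nonneg fun a _ => mul_nonneg (Policy.nonneg π 0 a) (p a).2.1

lemma stayProb_le_of_le {p : Fin k → unitInterval} {b : ℝ} (hb : ∀ a, (p a : ℝ) ≤ b)
    (π : Policy (Fin 2) (Fin k)) : stayProb p π ≤ b := by
  calc stayProb p π ≤ ∑ a, (π 0 : Fin k → ℝ) a * b :=
        Finset.sum_le_sum fun a _ => mul_le_mul_of_nonneg_left (hb a) (Policy.nonneg π 0 a)
    _ = b := by rw [← Finset.sum_mul, Policy.sum_eq_one π 0, one_mul]

variable (p : Fin k → unitInterval) (π : Policy (Fin 2) (Fin k))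

lemma twoState_step_reward (s : Fin 2) :
    ∫⁻ z, ENNReal.ofReal (z.2.2 : ℝ) ∂(twoState p).stepKernel π s = if s = 0 then 1 else 0 := by
  have hm : Measurable fun y : Fin 2 × unitInterval => ENNReal.ofReal (y.2 : ℝ) := by fun_prop
  rw [MDP.lintegral_stepKernel _ _ _ (by fun_prop)]
  obtain rfl | rfl : s = 0 ∨ s = 1 := by omega
  · have : ∀ a, ENNReal.ofReal (p a : ℝ) + ENNReal.ofReal (1 - (p a : ℝ)) = 1 := fun a => by
      rw [← ENNReal.ofReal_add (p a).2.1 (by linarith [(p a).2.2])]; simp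
    simp only [lintegral_twoState_zero p _ hm]
    simp only [Set.Icc.coe_one, ENNReal.ofReal_one, mul_one, this]
    rw [← ENNReal.ofReal_sum_of_nonneg fun a _ => Policy.nonneg π 0 a, Policy.sum_eq_one π 0]
    simp
  · simp only [lintegral_twoState_one p _ hm]
    simp

lemma twoState_step_stay (s : Fin 2) :
    ∫⁻ z, (if z.2.1 = 0 then 1 else 0) ∂(twoState p).stepKernel π s =
      if s = 0 then ENNReal.ofReal (stayProb p π) else 0 := by
  have hm : Measurable fun y : Fin 2 × unitInterval => if y.1 = 0 then (1 : ℝ≥0∞) else 0 :=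
    (measurable_from_top (f := fun s : Fin 2 => if s = 0 then (1 : ℝ≥0∞) else 0)).comp
      measurable_fst
  rw [MDP.lintegral_stepKernel _ _ _ (by exact hm.comp measurable_snd)]
  obtain rfl | rfl : s = 0 ∨ s = 1 := by omega
  · simp only [lintegral_twoState_zero p _ hm]
    rw [stayProb,
      ENNReal.ofReal_sum_of_nonneg fun a _ => mul_nonneg (Policy.nonneg π 0 a) (p a).2.1]
    simp [ENNReal.ofReal_mul (Policy.nonneg π 0 _)]
  · simp only [lintegral_twoState_one p _ hm]
    simp

/-- After the first step, the expected reward at time `n + 1` is the probability `x * stayProb p π ^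
n` of still being in state `0`, so the return is a geometric series. Leaving the first step free
covers `v` and `q` at once. -/
lemma twoState_return (μ₀ : Measure ((Fin 2 × Fin k) × (Fin 2 × unitInterval)))
    [IsProbabilityMeasure μ₀] {γ r x : ℝ} (h0 : 0 ≤ γ) (h1 : γ < 1) (hr0 : 0 ≤ r) (hx0 : 0 ≤ x)
    (hr : ∫⁻ z, ENNReal.ofReal (z.2.2 : ℝ) ∂μ₀ = ENNReal.ofReal r)
    (hx : ∫⁻ z, (if z.2.1 = 0 then 1 else 0) ∂μ₀ = ENNReal.ofReal x) :
    ∫ ω, discountedReturn γ ω ∂(twoState p).traj π μ₀ = r + γ * x / (1 - γ * stayProb p π) := by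
  have hm : Measurable fun z : (Fin 2 × Fin k) × (Fin 2 × unitInterval) =>
      if z.2.1 = 0 then (1 : ℝ≥0∞) else 0 :=
    (measurable_from_top (f := fun s : Fin 2 => if s = 0 then (1 : ℝ≥0∞) else 0)).comp
      (measurable_fst.comp measurable_snd)
  have hP := stayProb_nonneg p π
  have hP1 : stayProb p π ≤ 1 := stayProb_le_of_le (fun a => (p a).2.2) π
  have hstay : ∀ n, ∫⁻ ω, (if (ω n).2.1 = 0 then 1 else 0) ∂(twoState p).traj π μ₀ =
      ENNReal.ofReal (x * stayProb p π ^ n) := by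
    intro n
    induction n with
    | zero => rw [MDP.lintegral_traj_zero _ _ _ hm, hx]; simp
    | succ n ih =>
      rw [MDP.lintegral_traj_succ _ _ _ hm]
      simp only [twoState_step_stay]
      rw [pow_succ, ← mul_assoc, mul_comm, ENNReal.ofReal_mul hP, ← ih, ← lintegral_const_mul]
      · simp
      · exact hm.comp (measurable_pi_apply n)
  let e : ℕ → ℝ := fun t => Nat.casesOn t r fun n => x * stayProb p π ^ n
  have he0 : e 0 = r := rfl
  have heS : ∀ n, e (n + 1) = x * stayProb p π ^ n := fun n => rfl
  have hepos : ∀ t, 0 ≤ e t := by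
    rintro (_ | n)
    · exact hr0
    · rw [heS]; positivity
  have he : ∀ t, ∫⁻ ω, ENNReal.ofReal ((ω t).2.2 : ℝ) ∂(twoState p).traj π μ₀ =
      ENNReal.ofReal (e t) := by
    rintro (_ | n)
    · rw [MDP.lintegral_traj_zero (f := fun z => ENNReal.ofReal (z.2.2 : ℝ)) _ _ _ (by fun_prop),
        hr, he0]
    · rw [MDP.lintegral_traj_succ (f := fun z => ENNReal.ofReal (z.2.2 : ℝ)) _ _ _ (by fun_prop),
        heS, ← hstay]
      simp only [twoState_step_reward]
  have hlt : γ * stayProb p π < 1 := by nlinarith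
  have hsum : HasSum (fun n => γ ^ (n + 1) * e (n + 1)) (γ * x / (1 - γ * stayProb p π)) := by
    have := (hasSum_geometric_of_lt_one (mul_nonneg h0 hP) hlt).mul_left (γ * x)
    rw [div_eq_mul_inv]
    refine this.congr_fun fun n => ?_
    rw [heS, mul_pow]; ring
  rw [MDP.integral_discountedReturn _ _ _ h0 h1 he hepos]
  have := (hasSum_nat_add_iff (f := fun t => γ ^ t * e t) 1).1 hsum
  rw [this.tsum_eq]
  simp [he0, add_comm]

lemma twoState_v_zero {γ : ℝ} (h0 : 0 ≤ γ) (h1 : γ < 1) :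
    (twoState p).v γ π 0 = (1 - γ * stayProb p π)⁻¹ := by
  have hP := stayProb_nonneg p π
  have hP1 : stayProb p π ≤ 1 := stayProb_le_of_le (fun a => (p a).2.2) π
  have hlt : γ * stayProb p π < 1 := by nlinarith
  have := twoState_return p π ((twoState p).stepKernel π 0) h0 h1 zero_le_one hP
    (by rw [twoState_step_reward]; simp) (by rw [twoState_step_stay]; simp)
  rw [MDP.v]
  refine this.trans ?_
  have : 1 - γ * stayProb p π ≠ 0 := by linarith
  field_simp
  ring

lemma twoState_q_zero (a : Fin k) {γ : ℝ} (h0 : 0 ≤ γ) (h1 : γ < 1) :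
    (twoState p).q γ π 0 a = 1 + γ * p a / (1 - γ * stayProb p π) := by
  have hm : Measurable fun y : Fin 2 × unitInterval => if y.1 = 0 then (1 : ℝ≥0∞) else 0 :=
    (measurable_from_top (f := fun s : Fin 2 => if s = 0 then (1 : ℝ≥0∞) else 0)).comp
      measurable_fst
  refine twoState_return p π ((Measure.dirac (0, a)).prod ((twoState p).Q (0, a))) h0 h1
    zero_le_one (p a).2.1 ?_ ?_
  · rw [Measure.dirac_prod, lintegral_map (by fun_prop) measurable_prodMk_left,
      lintegral_twoState_zero p a (f := fun y => ENNReal.ofReal (y.2 : ℝ)) (by fun_prop)]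
    simp only [Set.Icc.coe_one, ENNReal.ofReal_one, mul_one]
    rw [← ENNReal.ofReal_add (p a).2.1 (by linarith [(p a).2.2])]; simp
  · rw [Measure.dirac_prod, lintegral_map (by exact hm.comp measurable_snd) measurable_prodMk_left,
      lintegral_twoState_zero p a hm]
    simp

lemma twoState_q_one (a : Fin k) {γ : ℝ} (h0 : 0 ≤ γ) (h1 : γ < 1) :
    (twoState p).q γ π 1 a = 0 := by
  have hm : Measurable fun y : Fin 2 × unitInterval => if y.1 = 0 then (1 : ℝ≥0∞) else 0 :=
    (measurable_from_top (f := fun s : Fin 2 => if s = 0 then (1 : ℝ≥0∞) else 0)).comp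
      measurable_fst
  refine (twoState_return p π ((Measure.dirac (1, a)).prod ((twoState p).Q (1, a))) h0 h1
    (r := 0) (x := 0) le_rfl le_rfl ?_ ?_).trans (by simp)
  · rw [Measure.dirac_prod, lintegral_map (by fun_prop) measurable_prodMk_left,
      lintegral_twoState_one p a (f := fun y => ENNReal.ofReal (y.2 : ℝ)) (by fun_prop)]
    simp
  · rw [Measure.dirac_prod, lintegral_map (by exact hm.comp measurable_snd) measurable_prodMk_left,
      lintegral_twoState_one p a hm]
    simp

end TwoState

/-! ### Perturbed chains and the gap to optimality. -/

section ValueGap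

variable {k : ℕ}

/-- The probability of staying in state `0`, as a function of the perturbation `y` of its product
with the discount factor. -/
def stay (γ y : ℝ) : unitInterval := Set.projIcc 0 1 zero_le_one (2 - (1 - y) / γ)

/-- The two-state MDP with perturbations `y`. -/
def perturbed (γ : ℝ) (y : Fin k → ℝ) : MDP (Fin 2) (Fin k) := twoState fun a => stay γ (y a)

/-- Under these bounds the projection onto `[0, 1]` is inactive: `2 * γ - 1 ≥ 1 / 6` dominates `|y|
≤ 1 / 12`, and the upper bound needs only `y ≤ 1 - γ`. -/
lemma mul_stay {γ y : ℝ} (hγ : 7 / 12 ≤ γ) (hγ1 : γ < 1) (hy : |y| ≤ (1 - γ) / 5) :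
    γ * (stay γ y : ℝ) = 2 * γ - 1 + y := by
  have h := abs_le.1 hy
  have hpos : 0 < γ := by linarith
  have hmem : 2 - (1 - y) / γ ∈ Set.Icc (0 : ℝ) 1 := by
    constructor
    · rw [sub_nonneg, div_le_iff₀ hpos]; linarith
    · rw [sub_le_iff_le_add, ← sub_le_iff_le_add', le_div_iff₀ hpos]; linarith
  rw [stay, Set.projIcc_of_mem _ hmem]
  field_simp
  ring

/-- The mean of `y` under the policy `π` in state `0`. -/
def policyMean (y : Fin k → ℝ) (π : Policy (Fin 2) (Fin k)) : ℝ :=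
  ∑ a, (π 0 : Fin k → ℝ) a * y a

lemma mul_stayProb {γ : ℝ} {y : Fin k → ℝ} (hγ : 7 / 12 ≤ γ) (hγ1 : γ < 1)
    (hy : ∀ a, |y a| ≤ (1 - γ) / 5) (π : Policy (Fin 2) (Fin k)) :
    γ * stayProb (fun a => stay γ (y a)) π = 2 * γ - 1 + policyMean y π := by
  rw [stayProb, Finset.mul_sum, policyMean]
  calc ∑ a, γ * ((π 0 : Fin k → ℝ) a * (stay γ (y a) : ℝ))
      = ∑ a, ((π 0 : Fin k → ℝ) a * (2 * γ - 1) + (π 0 : Fin k → ℝ) a * y a) := by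
        refine Finset.sum_congr rfl fun a _ => ?_
        rw [mul_left_comm, mul_stay hγ hγ1 (hy a)]; ring
    _ = _ := by rw [Finset.sum_add_distrib, ← Finset.sum_mul, Policy.sum_eq_one, one_mul]

lemma policyMean_le {y : Fin k → ℝ} {D : ℝ} (hy : ∀ a, y a ≤ D) (π : Policy (Fin 2) (Fin k)) :
    policyMean y π ≤ D := by
  calc policyMean y π ≤ ∑ a, (π 0 : Fin k → ℝ) a * D :=
        Finset.sum_le_sum fun a _ => mul_le_mul_of_nonneg_left (hy a) (π.nonneg 0 a)
    _ = D := by rw [← Finset.sum_mul, Policy.sum_eq_one, one_mul]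

lemma policyMean_detPolicy (y : Fin k → ℝ) (f : Fin 2 → Fin k) :
    policyMean y (detPolicy f) = y (f 0) := by
  simp [policyMean, detPolicy, Pi.single_apply]

lemma perturbed_v {γ : ℝ} {y : Fin k → ℝ} (hγ : 7 / 12 ≤ γ) (hγ1 : γ < 1)
    (hy : ∀ a, |y a| ≤ (1 - γ) / 5) (π : Policy (Fin 2) (Fin k)) :
    (perturbed γ y).v γ π 0 = (2 * (1 - γ) - policyMean y π)⁻¹ := by
  rw [perturbed, twoState_v_zero _ _ (by linarith) hγ1, mul_stayProb hγ hγ1 hy]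
  congr 1; ring

lemma perturbed_q {γ : ℝ} {y : Fin k → ℝ} (hγ : 7 / 12 ≤ γ) (hγ1 : γ < 1)
    (hy : ∀ a, |y a| ≤ (1 - γ) / 5) (π : Policy (Fin 2) (Fin k)) (a : Fin k) :
    (perturbed γ y).q γ π 0 a =
      1 + (2 * γ - 1 + y a) * (2 * (1 - γ) - policyMean y π)⁻¹ := by
  rw [perturbed, twoState_q_zero _ _ _ (by linarith) hγ1, mul_stayProb hγ hγ1 hy,
    mul_stay hγ hγ1 (hy a), div_eq_mul_inv]
  congr 3; ring

/-- A nearly optimal policy for the two-state MDP with perturbations `y` has a mean perturbation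
close to the largest one. -/
lemma sub_policyMean_lt {γ α D : ℝ} {y : Fin k → ℝ} (hγ : 7 / 12 ≤ γ) (hγ1 : γ < 1)
    (hα : 0 < α) (hα' : α * (1 - γ) ≤ 1 / 80) (hD : 4 * α * (1 - γ) ^ 2 ≤ D)
    (hy : ∀ a, |y a| ≤ (1 - γ) / 5) (hyD : ∀ a, y a ≤ D) {a : Fin k} (ha : y a = D)
    {π : Policy (Fin 2) (Fin k)}
    (hπ : (perturbed γ y).vStar γ 0 - (perturbed γ y).v γ π 0 ≤ α) :
    D - policyMean y π < 4 * α * (1 - γ) ^ 2 := by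
  set g := 1 - γ with hg
  have hg0 : 0 < g := by linarith
  have hDg : D ≤ g / 5 := ha ▸ (abs_le.1 (hy a)).2
  have hDpos : 0 < D := lt_of_lt_of_le (by positivity) hD
  have hm := policyMean_le hyD
  have hbdd : BddAbove (Set.range fun π => (perturbed γ y).v γ π 0) := by
    refine ⟨(2 * g - D)⁻¹, ?_⟩
    rintro _ ⟨π', rfl⟩
    simp only
    rw [perturbed_v hγ hγ1 hy]
    exact inv_anti₀ (by linarith) (by linarith [hm π'])
  -- The policy that always plays the best action `a` attains this value.
  have hstar : (2 * g - D)⁻¹ ≤ (perturbed γ y).vStar γ 0 := by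
    refine le_trans (le_of_eq ?_) (le_ciSup hbdd (detPolicy fun _ => a))
    rw [perturbed_v hγ hγ1 hy, policyMean_detPolicy, ha]
  set z := policyMean y π with hz
  have hzD : z ≤ D := hm π
  have h1 : 0 < 2 * g - D := by linarith
  have h2 : 0 < 2 * g - z := by linarith
  have h3 : (2 * g - D)⁻¹ - (2 * g - z)⁻¹ ≤ α := by
    rw [perturbed_v hγ hγ1 hy] at hπ
    linarith
  have h4 : D - z ≤ α * ((2 * g - D) * (2 * g - z)) := by
    have : (2 * g - D)⁻¹ - (2 * g - z)⁻¹ = (D - z) / ((2 * g - D) * (2 * g - z)) := by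
      field_simp; ring
    rwa [this, div_le_iff₀ (by positivity)] at h3
  rcases le_or_gt 0 z with h | h
  · have : (2 * g - D) * (2 * g - z) < 2 * g * (2 * g) := by nlinarith
    nlinarith
  -- For `z < 0`, `α * (2 * g - D) ≤ 1` lets the `-z` terms be cancelled in `h4`, leaving `D ≤ 2 * α
  -- * g * (2 * g - D) < 4 * α * g ^ 2`, against `hD`.
  · exfalso
    have e1 : α * (2 * g - D) * (2 * g - z) =
        α * (2 * g - D) * (2 * g) + α * (2 * g - D) * (-z) := by
      ring
    have e2 : α * (2 * g - D) ≤ 1 := by nlinarith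
    have e3 : α * (2 * g - D) * (-z) ≤ 1 * (-z) := by
      exact mul_le_mul_of_nonneg_right e2 (by linarith)
    nlinarith [mul_pos (mul_pos hα hDpos) hg0]

end ValueGap

/-! ### Feature maps, realizability and linearity. -/

section Features

variable {k m : ℕ}

/-- The vector `(a, b, w)`. -/
def blockVec (a b : ℝ) (w : EuclideanSpace ℝ (Fin m)) : EuclideanSpace ℝ (Fin (m + 2)) :=
  WithLp.toLp 2 (Fin.cons a (Fin.cons b fun i => w i))

lemma inner_blockVec (a b a' b' : ℝ) (w w' : EuclideanSpace ℝ (Fin m)) :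
    inner ℝ (blockVec a b w) (blockVec a' b' w') = a * a' + b * b' + inner ℝ w w' := by
  simp [blockVec, PiLp.inner_apply, Fin.sum_univ_succ]
  ring

lemma norm_blockVec_le (a b : ℝ) (w : EuclideanSpace ℝ (Fin m)) :
    ‖blockVec a b w‖ ≤ |a| + |b| + ‖w‖ := by
  refine abs_le_of_sq_le_sq' ?_ (by positivity) |>.2
  rw [← real_inner_self_eq_norm_sq, inner_blockVec, real_inner_self_eq_norm_sq]
  have := abs_nonneg a
  have := abs_nonneg b
  have := norm_nonneg w
  rw [← sq, ← sq, ← sq_abs a, ← sq_abs b]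
  nlinarith [mul_nonneg (abs_nonneg a) (abs_nonneg b), mul_nonneg (abs_nonneg a) (norm_nonneg w),
    mul_nonneg (abs_nonneg b) (norm_nonneg w)]

/-- The features `(1, 0, U a)` in state `0` and `(0, 1, 0)` in state `1`. -/
def blockFeature (U : Fin k → EuclideanSpace ℝ (Fin m)) (s : Fin 2) (a : Fin k) :
    EuclideanSpace ℝ (Fin (m + 2)) :=
  if s = 0 then blockVec 1 0 (U a) else blockVec 0 1 0

lemma norm_blockFeature_le {U : Fin k → EuclideanSpace ℝ (Fin m)} (hU : ∀ a, ‖U a‖ ≤ 1)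
    (s : Fin 2) (a : Fin k) : ‖blockFeature U s a‖ ≤ 2 := by
  unfold blockFeature
  split_ifs
  · refine (norm_blockVec_le _ _ _).trans ?_
    have := hU a
    norm_num
    linarith
  · refine (norm_blockVec_le _ _ _).trans ?_
    norm_num

/-- For a fixed policy, `q` at state `0` is `1 + (2 * γ - 1) * V + V * y a` with `V ≤ 5 / (9 * (1 -
γ))`. Replacing `y a` by `inner ℝ (U a) w` therefore costs at most `V * η ≤ ε`. -/
lemma perturbed_approxError_le {γ η ε : ℝ} {y : Fin k → ℝ} (hγ : 7 / 12 ≤ γ) (hγ1 : γ < 1)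
    (hy : ∀ a, |y a| ≤ (1 - γ) / 5) {U : Fin k → EuclideanSpace ℝ (Fin m)}
    {w : EuclideanSpace ℝ (Fin m)} (hw : ‖w‖ ≤ (1 - γ) / 5)
    (hη : ∀ a, |y a - inner ℝ (U a) w| ≤ η) (hε : η ≤ ε * (1 - γ)) :
    (perturbed γ y).approxError γ (blockFeature U) (2 / (1 - γ)) ≤ ENNReal.ofReal ε := by
  set g := 1 - γ with hg
  have hg0 : 0 < g := by linarith
  refine iSup_le fun f => ?_
  have hz := policyMean_le (fun a => (abs_le.1 (hy a)).2) (detPolicy f)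
  set z := policyMean y (detPolicy f) with hzdef
  set V := (2 * g - z)⁻¹ with hV
  have hV0 : 0 < V := inv_pos.2 (by linarith)
  have hVg : V * (9 * g / 5) ≤ 1 := by
    rw [hV, inv_mul_le_iff₀ (by linarith)]; linarith
  refine iInf₂_le_of_le (blockVec (1 + (2 * γ - 1) * V) 0 (V • w)) ?_ ?_
  · rw [mem_closedBall_zero_iff]
    refine (norm_blockVec_le _ _ _).trans ?_
    rw [abs_of_nonneg (by nlinarith), abs_zero, add_zero, norm_smul, Real.norm_eq_abs,
      abs_of_pos hV0, le_div_iff₀ hg0]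
    have hwV : V * ‖w‖ ≤ V * g := mul_le_mul_of_nonneg_left (by linarith) hV0.le
    have hγV : (2 * γ - 1) * V ≤ 1 * V := mul_le_mul_of_nonneg_right (by linarith) hV0.le
    calc (1 + (2 * γ - 1) * V + V * ‖w‖) * g ≤ (1 + 1 * V + V * g) * g := by gcongr
      _ = g + V * g + V * g * g := by ring
      _ ≤ 2 := by nlinarith [mul_pos hV0 hg0]
  · refine iSup_le fun s => iSup_le fun a => ENNReal.ofReal_le_ofReal ?_
    have hε0 : 0 ≤ ε := by
      have := (abs_nonneg _).trans (hη a)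
      by_contra h
      nlinarith
    obtain rfl | rfl : s = 0 ∨ s = 1 := by omega
    · rw [perturbed_q hγ hγ1 hy, ← hg, ← hzdef, ← hV, blockFeature, if_pos rfl, inner_blockVec,
        inner_smul_right]
      have : 1 + (2 * γ - 1 + y a) * V - (1 * (1 + (2 * γ - 1) * V) + 0 * 0 + V * inner ℝ (U a) w) =
          V * (y a - inner ℝ (U a) w) := by ring
      rw [this, abs_mul, abs_of_pos hV0]
      calc V * |y a - inner ℝ (U a) w| ≤ V * (ε * g) :=
            mul_le_mul_of_nonneg_left ((hη a).trans hε) hV0.le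
        _ ≤ ε := by nlinarith
    · rw [perturbed, twoState_q_one _ _ _ (by linarith) hγ1, blockFeature, if_neg (by decide),
        inner_blockVec]
      simpa using hε0

lemma twoState_reward_zero (p : Fin k → unitInterval) (a : Fin k) :
    (twoState p).reward 0 a = 1 := by
  rw [MDP.reward, twoState_Q_zero, integral_add_measure, integral_smul_measure,
    integral_smul_measure, integral_dirac, integral_dirac, ENNReal.toReal_ofReal (p a).2.1,
    ENNReal.toReal_ofReal (by linarith [(p a).2.2])]
  · simp
  · exact (integrable_dirac (by simp)).smul_measure (by simp)
  · exact (integrable_dirac (by simp)).smul_measure (by simp)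

lemma twoState_reward_one (p : Fin k → unitInterval) (a : Fin k) :
    (twoState p).reward 1 a = 0 := by
  rw [MDP.reward, twoState_Q_one, integral_dirac]
  simp

lemma twoState_prob_zero (p : Fin k → unitInterval) (a : Fin k) (s : Fin 2) :
    (twoState p).prob 0 a s = if s = 0 then (p a : ℝ) else 1 - p a := by
  have h1 : (1 : ℝ) - p a ≥ 0 := by linarith [(p a).2.2]
  have hm : MeasurableSet {x : Fin 2 × unitInterval | x.1 = s} :=
    measurable_fst (measurableSet_singleton s)
  rw [MDP.prob, twoState_Q_zero, Measure.real, Measure.add_apply, Measure.smul_apply,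
    Measure.smul_apply, Measure.dirac_apply' _ hm, Measure.dirac_apply' _ hm]
  obtain rfl | rfl : s = 0 ∨ s = 1 := by omega
  · simp [Set.indicator, (p a).2.1]
  · simp [Set.indicator, h1]

lemma twoState_prob_one (p : Fin k → unitInterval) (a : Fin k) (s : Fin 2) :
    (twoState p).prob 1 a s = if s = 0 then 0 else 1 := by
  have hm : MeasurableSet {x : Fin 2 × unitInterval | x.1 = s} :=
    measurable_fst (measurableSet_singleton s)
  rw [MDP.prob, twoState_Q_one, Measure.real, Measure.dirac_apply' _ hm]
  obtain rfl | rfl : s = 0 ∨ s = 1 := by omega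
  · simp [Set.indicator]
  · simp [Set.indicator]

/-- The staying probability is `2 - γ⁻¹ + γ⁻¹ * y a`, affine in `y a` and so linear in `(1, U a)`.
The second feature coordinate is there for the absorbing state, whose self-transition has
probability `1`. -/
lemma perturbed_isLinear {γ : ℝ} {y : Fin k → ℝ} (hγ : 7 / 12 ≤ γ) (hγ1 : γ < 1)
    (hy : ∀ a, |y a| ≤ (1 - γ) / 5) {U : Fin k → EuclideanSpace ℝ (Fin m)} (hU : ∀ a, ‖U a‖ ≤ 1)
    {w : EuclideanSpace ℝ (Fin m)} (hw : ‖w‖ ≤ (1 - γ) / 5) (hyw : ∀ a, y a = inner ℝ (U a) w) :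
    (perturbed γ y).IsLinear (blockFeature U) 2 (2 / (1 - γ)) := by
  have hg0 : 0 < 1 - γ := by linarith
  have hpos : 0 < γ := by linarith
  have hB : 4 ≤ 2 / (1 - γ) := by rw [le_div_iff₀ hg0]; linarith
  have hinv : 1 ≤ γ⁻¹ := (one_le_inv₀ hpos).2 hγ1.le
  have hinv2 : γ⁻¹ ≤ 12 / 7 := by
    rw [inv_le_comm₀ hpos (by norm_num)]; norm_num; linarith
  have hstay : ∀ a, (stay γ (y a) : ℝ) = 2 - γ⁻¹ + γ⁻¹ * inner ℝ (U a) w := fun a => by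
    have := mul_stay hγ hγ1 (hy a)
    rw [← hyw]
    field_simp
    linarith
  refine ⟨norm_blockFeature_le hU,
    fun s => if s = 0 then blockVec (2 - γ⁻¹) 0 (γ⁻¹ • w) else blockVec (γ⁻¹ - 1) 1 (-(γ⁻¹ • w)),
    blockVec 1 0 0, ?_, Summable.of_finite, ?_, ?_, ?_⟩
  · refine (norm_blockVec_le _ _ _).trans ?_
    norm_num
    linarith
  · have hw' : γ⁻¹ * ‖w‖ ≤ 1 / 2 := by
      calc γ⁻¹ * ‖w‖ ≤ 12 / 7 * ((1 - γ) / 5) := by gcongr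
        _ ≤ 1 / 2 := by linarith
    have n1 := norm_blockVec_le (2 - γ⁻¹) 0 (γ⁻¹ • w)
    have n2 := norm_blockVec_le (γ⁻¹ - 1) 1 (-(γ⁻¹ • w))
    rw [norm_smul, Real.norm_of_nonneg (by positivity), abs_of_nonneg (by linarith)] at n1
    rw [norm_neg, norm_smul, Real.norm_of_nonneg (by positivity), abs_of_nonneg (by linarith)] at n2
    rw [tsum_fintype, Fin.sum_univ_two]
    simp only [if_true, one_ne_zero, if_false]
    norm_num at n1 n2
    linarith
  · intro s a
    obtain rfl | rfl : s = 0 ∨ s = 1 := by omega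
    · rw [perturbed, twoState_reward_zero, blockFeature, if_pos rfl, inner_blockVec]
      simp
    · rw [perturbed, twoState_reward_one, blockFeature, if_neg (by decide), inner_blockVec]
      simp
  · intro s a s'
    obtain rfl | rfl : s = 0 ∨ s = 1 := by omega
    · rw [perturbed, twoState_prob_zero, blockFeature, if_pos rfl, hstay]
      beta_reduce
      split_ifs
      · rw [inner_blockVec, inner_smul_right]; ring
      · rw [inner_blockVec, inner_neg_right, inner_smul_right]; ring
    · rw [perturbed, twoState_prob_one, blockFeature, if_neg one_ne_zero]
      beta_reduce
      split_ifs
      · rw [inner_blockVec]; simp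
      · rw [inner_blockVec]; simp

end Features

/-! ### Divergence between the answers of two perturbed chains. -/

section Divergence

variable {k : ℕ}

/-- The second moment of the likelihood ratio is `p ^ 2 / p' + (1 - p) ^ 2 / (1 - p') = 1 + (p - p')
^ 2 / (p' * (1 - p'))`; the inequality is Cauchy–Schwarz, with the defect written as an explicit
square. -/
lemma bernoulli_sq_le {p p' C : ℝ} (hp : 0 ≤ p) (hp1 : p ≤ 1) (h0 : 0 < p') (h1 : p' < 1)
    (hC : 1 + (p - p') ^ 2 / (p' * (1 - p')) ≤ C) (f₀ f₁ : ℝ≥0∞) :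
    (ENNReal.ofReal p * f₀ + ENNReal.ofReal (1 - p) * f₁) ^ 2 ≤
      ENNReal.ofReal C * (ENNReal.ofReal p' * f₀ ^ 2 + ENNReal.ofReal (1 - p') * f₁ ^ 2) := by
  have h1' : 0 < 1 - p' := by linarith
  have hCpos : 0 < C := by
    have : 0 ≤ (p - p') ^ 2 / (p' * (1 - p')) := by positivity
    linarith
  have hne : ENNReal.ofReal C ≠ 0 := by simpa using hCpos
  rcases eq_or_ne f₀ ⊤ with rfl | hf0
  · have : ENNReal.ofReal p' ≠ 0 := by simpa using h0
    simp [ENNReal.mul_top this, ENNReal.mul_top hne]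
  rcases eq_or_ne f₁ ⊤ with rfl | hf1
  · have : ENNReal.ofReal (1 - p') ≠ 0 := by simpa using h1'
    simp [ENNReal.mul_top this, ENNReal.mul_top hne]
  lift f₀ to NNReal using hf0
  lift f₁ to NNReal using hf1
  have hx := f₀.coe_nonneg
  have hy := f₁.coe_nonneg
  rw [← ENNReal.ofReal_coe_nnreal, ← ENNReal.ofReal_coe_nnreal, ← ENNReal.ofReal_mul hp,
    ← ENNReal.ofReal_mul (by linarith), ← ENNReal.ofReal_add (by positivity)
      (mul_nonneg (by linarith) (by positivity)),
    ← ENNReal.ofReal_pow hx, ← ENNReal.ofReal_pow hy,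
    ← ENNReal.ofReal_mul h0.le, ← ENNReal.ofReal_mul h1'.le, ← ENNReal.ofReal_add (by positivity)
      (by positivity), ← ENNReal.ofReal_mul hCpos.le, ← ENNReal.ofReal_pow
      (add_nonneg (by positivity) (mul_nonneg (by linarith) (by positivity)))]
  refine ENNReal.ofReal_le_ofReal ?_
  generalize (f₀ : ℝ) = x at *
  generalize (f₁ : ℝ) = y at *
  refine le_trans ?_ (mul_le_mul_of_nonneg_right hC (by positivity))
  have hden : 0 < p' * (1 - p') := by positivity
  have : 1 + (p - p') ^ 2 / (p' * (1 - p')) =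
      (p ^ 2 * (1 - p') + (1 - p) ^ 2 * p') / (p' * (1 - p')) := by
    field_simp; ring
  rw [this, div_mul_eq_mul_div, le_div_iff₀ hden]
  have : (p ^ 2 * (1 - p') + (1 - p) ^ 2 * p') * (p' * x ^ 2 + (1 - p') * y ^ 2) -
      (p * x + (1 - p) * y) ^ 2 * (p' * (1 - p')) =
      ((1 - p) * p' * x - p * (1 - p') * y) ^ 2 := by ring
  nlinarith [sq_nonneg ((1 - p) * p' * x - p * (1 - p') * y)]

lemma perturbed_sq_lintegral_le {γ η : ℝ} {y y' : Fin k → ℝ} (hγ : 7 / 12 ≤ γ) (hγ1 : γ < 1)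
    (hy : ∀ a, |y a| ≤ (1 - γ) / 5) (hy' : ∀ a, |y' a| ≤ (1 - γ) / 5)
    (hη : ∀ a, |y a - y' a| ≤ η) (x : Fin 2 × Fin k)
    (f : Fin 2 × unitInterval → ℝ≥0∞) (hf : Measurable f) :
    (∫⁻ z, f z ∂(perturbed γ y).Q x) ^ 2 ≤
      ENNReal.ofReal (1 + 15 * η ^ 2 / (1 - γ)) * ∫⁻ z, f z ^ 2 ∂(perturbed γ y').Q x := by
  have hg0 : 0 < 1 - γ := by linarith
  have hpos : 0 < γ := by linarith
  obtain ⟨s, a⟩ := x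
  obtain rfl | rfl : s = 0 ∨ s = 1 := by omega
  · rw [perturbed, perturbed, lintegral_twoState_zero _ _ hf,
      lintegral_twoState_zero _ _ (hf.pow_const 2)]
    have e := mul_stay hγ hγ1 (hy a)
    have e' := mul_stay hγ hγ1 (hy' a)
    have b' := abs_le.1 (hy' a)
    set p : ℝ := (stay γ (y a) : ℝ) with hp
    set p' : ℝ := (stay γ (y' a) : ℝ) with hp'
    have l1 : 1 / 12 ≤ γ * p' := by rw [e']; linarith
    have l2 : 4 / 5 * (1 - γ) ≤ γ * (1 - p') := by linarith
    have p0 : 0 < p' := by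
      by_contra h
      nlinarith
    have p1 : 0 < 1 - p' := by
      by_contra h
      nlinarith
    refine bernoulli_sq_le (stay γ (y a)).2.1 (stay γ (y a)).2.2 p0 (by linarith) ?_ _ _
    have hsq : (γ * (p - p')) ^ 2 ≤ η ^ 2 := by
      have : γ * (p - p') = y a - y' a := by rw [mul_sub, e, e']; ring
      rw [this]
      exact sq_le_sq' (by linarith [(abs_le.1 (hη a)).1]) (abs_le.1 (hη a)).2
    -- The product of `l1` and `l2`. The variance of one answer is of order `1 - γ`, which accounts
    -- for one power of `1 - γ` in the final bound.
    have hlow : 1 / 15 * (1 - γ) ≤ γ ^ 2 * (p' * (1 - p')) := by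
      have := mul_le_mul l1 l2 (by positivity) (by positivity)
      nlinarith
    refine add_le_add_right ((div_le_div_iff₀ (by positivity) hg0).2 ?_) 1
    rw [← hp]
    have h1 : (p - p') ^ 2 * (1 - γ) ≤ (p - p') ^ 2 * (15 * (γ ^ 2 * (p' * (1 - p')))) :=
      mul_le_mul_of_nonneg_left (by linarith) (sq_nonneg _)
    have h2 : (γ * (p - p')) ^ 2 * (p' * (1 - p')) ≤ η ^ 2 * (p' * (1 - p')) :=
      mul_le_mul_of_nonneg_right hsq (by positivity)
    nlinarith
  · rw [perturbed, perturbed, lintegral_twoState_one _ _ hf,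
      lintegral_twoState_one _ _ (hf.pow_const 2)]
    refine le_mul_of_one_le_left zero_le (ENNReal.one_le_ofReal.2 ?_)
    have : 0 ≤ 15 * η ^ 2 / (1 - γ) := by positivity
    linarith

end Divergence

/-! ### Consequences of soundness. -/

section Soundness

variable {S A : Type*} [MeasurableSpace S] [Fintype A] [MeasurableSpace A]

lemma Planner.lintegral_le_queryComplexity (p : Planner S A) {𝓜 : Set (MDP S A)} {M : MDP S A}
    (hM : M ∈ 𝓜) : ∫⁻ x, (x.1 : ℝ≥0∞) ∂p.runLaw M ≤ p.queryComplexity 𝓜 :=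
  le_self_add.trans (le_iSup₂_of_le (f := fun M _ => p.expectedQueries M) M hM le_rfl)

/-- Measurability is asked only of `E`, a part of the failure event; the success event itself enters
just through monotonicity. -/
lemma Planner.IsSoundFor.runLaw_le [Countable S] [MeasurableSingletonClass S] {p : Planner S A}
    {M : MDP S A} {γ α δ : ℝ} {s₀ : S} (h : p.IsSoundFor M γ s₀ α δ) (hδ : 0 ≤ δ) (hδ1 : δ ≤ 1)
    {E : Set (Outcome S A)} (hE : MeasurableSet E)
    (hbad : ∀ x ∈ E, α < M.vStar γ s₀ - M.v γ x.2.2 s₀) : p.runLaw M E ≤ ENNReal.ofReal δ := by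
  have : IsProbabilityMeasure (p.runLaw M) := ⟨h.1⟩
  have h1 : ENNReal.ofReal (1 - δ) ≤ p.runLaw M Eᶜ := h.2.trans <| measure_mono fun x hx hxE =>
    absurd (hbad x hxE) (not_lt.2 hx)
  have h2 : p.runLaw M E + ENNReal.ofReal (1 - δ) ≤ ENNReal.ofReal δ + ENNReal.ofReal (1 - δ) := by
    rw [← ENNReal.ofReal_add hδ (by linarith)]
    calc _ ≤ p.runLaw M E + p.runLaw M Eᶜ := by gcongr
      _ = 1 := prob_add_prob_compl hE
      _ = _ := by simp
  exact (ENNReal.add_le_add_iff_right ENNReal.ofReal_ne_top).1 h2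

end Soundness

/-! ### Sign vectors, their correlations and a packing bound. -/

section Signs

variable {m : ℕ}

/-- The sign `±1` of a truth value. -/
def boolSign (b : Bool) : ℝ := if b then 1 else -1

lemma abs_boolSign (b : Bool) : |boolSign b| = 1 := by cases b <;> simp [boolSign]

lemma boolSign_mul_self (b : Bool) : boolSign b * boolSign b = 1 := by
  cases b <;> simp [boolSign]

/-- The number of agreements minus the number of disagreements of two sign vectors. -/
def signCorr (a b : Fin m → Bool) : ℝ := ∑ i, boolSign (a i) * boolSign (b i)

lemma signCorr_self (a : Fin m → Bool) : signCorr a a = m := by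
  simp [signCorr, boolSign_mul_self]

lemma signCorr_comm (a b : Fin m → Bool) : signCorr a b = signCorr b a := by
  simp [signCorr, mul_comm]

lemma abs_signCorr_le (a b : Fin m → Bool) : |signCorr a b| ≤ m := by
  refine (Finset.abs_sum_le_sum_abs _ _).trans ?_
  simp [abs_mul, abs_boolSign]

lemma abs_signCorr_sub_update_le (a b : Fin m → Bool) (i : Fin m) :
    |signCorr a b - signCorr (Function.update a i (!a i)) b| ≤ 2 := by
  rw [signCorr, signCorr, ← Finset.sum_sub_distrib, Finset.sum_eq_single i]
  · rw [Function.update_self, ← sub_mul, abs_mul, abs_boolSign, mul_one]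
    cases a i <;> norm_num [boolSign]
  · intro j _ hj
    simp [Function.update_of_ne hj]
  · simp

/-- The unit vector with entries `±1 / √m` given by a sign vector. -/
def signVec (a : Fin m → Bool) : EuclideanSpace ℝ (Fin m) :=
  WithLp.toLp 2 fun i => boolSign (a i) / √m

lemma inner_signVec (a b : Fin m → Bool) : inner ℝ (signVec a) (signVec b) = signCorr a b / m := by
  rw [signCorr, Finset.sum_div]
  simp only [signVec, PiLp.inner_apply, RCLike.inner_apply, conj_trivial]
  refine Finset.sum_congr rfl fun i _ => ?_
  rw [div_mul_div_comm, Real.mul_self_sqrt (by positivity), mul_comm]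

lemma norm_signVec (hm : 0 < m) (a : Fin m → Bool) : ‖signVec a‖ = 1 := by
  have h : ‖signVec a‖ ^ 2 = 1 := by
    rw [← real_inner_self_eq_norm_sq, inner_signVec, signCorr_self, div_self (by positivity)]
  nlinarith [norm_nonneg (signVec a)]

lemma sum_exp_signCorr (a : Fin m → Bool) (t : ℝ) :
    ∑ b, Real.exp (t * signCorr a b) = (2 * Real.cosh t) ^ m := by
  have h : ∀ b : Fin m → Bool, Real.exp (t * signCorr a b) =
      ∏ i, Real.exp (t * (boolSign (a i) * boolSign (b i))) := fun b => by
    rw [← Real.exp_sum, signCorr, Finset.mul_sum]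
  simp_rw [h]
  have := Finset.prod_univ_sum (fun _ : Fin m => (Finset.univ : Finset Bool))
    fun i x => Real.exp (t * (boolSign (a i) * boolSign x))
  rw [Fintype.piFinset_univ] at this
  rw [← this]
  rw [Finset.prod_congr rfl (g := fun _ => 2 * Real.cosh t)]
  · simp
  · intro i _
    rw [Real.cosh_eq]
    cases a i <;> simp [boolSign] <;> ring

/-- A Hoeffding bound for the correlation with a fixed sign vector. -/
lemma card_lt_abs_signCorr_le (a : Fin m → Bool) {μ : ℝ} (hμ : 0 ≤ μ) :
    ((Finset.univ.filter fun b => μ * m < |signCorr a b|).card : ℝ) ≤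
      2 * 2 ^ m * Real.exp (-(m * μ ^ 2 / 2)) := by
  -- Chernoff's method with exponent parameter `μ`, the minimizer of `-t * μ + t ^ 2 / 2`.
  have hcosh : Real.cosh μ ≤ Real.exp (μ ^ 2 / 2) := Real.cosh_le_exp_half_sq μ
  have hpt : ∀ b : Fin m → Bool, (if μ * m < |signCorr a b| then (1 : ℝ) else 0) ≤
      Real.exp (-(m * μ ^ 2)) *
        (Real.exp (μ * signCorr a b) + Real.exp (-μ * signCorr a b)) := by
    intro b
    split_ifs with hb
    · rw [mul_add, ← Real.exp_add, ← Real.exp_add]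
      rcases lt_abs.1 hb with h | h
      · have : 1 ≤ Real.exp (-(m * μ ^ 2) + μ * signCorr a b) := Real.one_le_exp (by nlinarith)
        linarith [Real.exp_pos (-(m * μ ^ 2) + -μ * signCorr a b)]
      · have : 1 ≤ Real.exp (-(m * μ ^ 2) + -μ * signCorr a b) := Real.one_le_exp (by nlinarith)
        linarith [Real.exp_pos (-(m * μ ^ 2) + μ * signCorr a b)]
    · positivity
  calc ((Finset.univ.filter fun b => μ * m < |signCorr a b|).card : ℝ)
      = ∑ b, if μ * m < |signCorr a b| then (1 : ℝ) else 0 := by simp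
    _ ≤ ∑ b, Real.exp (-(m * μ ^ 2)) *
        (Real.exp (μ * signCorr a b) + Real.exp (-μ * signCorr a b)) :=
      Finset.sum_le_sum fun b _ => hpt b
    _ = 2 * 2 ^ m * (Real.exp (-(m * μ ^ 2)) * Real.cosh μ ^ m) := by
      rw [← Finset.mul_sum, Finset.sum_add_distrib, sum_exp_signCorr, sum_exp_signCorr,
        Real.cosh_neg, mul_pow]
      ring
    _ ≤ 2 * 2 ^ m * (Real.exp (-(m * μ ^ 2)) * Real.exp (μ ^ 2 / 2) ^ m) := by
      have := Real.cosh_pos μ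
      gcongr
    _ = 2 * 2 ^ m * Real.exp (-(m * μ ^ 2 / 2)) := by
      rw [← Real.exp_nat_mul, ← Real.exp_add]
      congr 2; ring

/-- There are exponentially many nearly orthogonal sign vectors. -/
lemma exists_nearly_orthogonal (hm : 0 < m) {μ : ℝ} (hμ : 0 ≤ μ) (hμ1 : μ < 1) :
    ∃ T : Finset (Fin m → Bool), (∀ a ∈ T, ∀ b ∈ T, a ≠ b → |signCorr a b| ≤ μ * m) ∧
      Real.exp (m * μ ^ 2 / 2) ≤ 2 * T.card := by
  classical
  let P : Finset (Fin m → Bool) → Prop :=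
    fun T => ∀ a ∈ T, ∀ b ∈ T, a ≠ b → |signCorr a b| ≤ μ * m
  obtain ⟨T, hT, hmax⟩ := Finset.exists_max_image (Finset.univ.filter P) Finset.card
    ⟨∅, by simp [P]⟩
  have hP : P T := (Finset.mem_filter.1 hT).2
  refine ⟨T, hP, ?_⟩
  -- A vector correlated with no member of the maximal family `T` could be added to it. Members of
  -- `T` are covered by themselves, as `μ < 1`.
  have hcover : (Finset.univ : Finset (Fin m → Bool)) ⊆
      T.biUnion fun a => Finset.univ.filter fun b => μ * m < |signCorr a b| := by
    intro b _
    by_contra hb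
    simp only [Finset.mem_biUnion, Finset.mem_filter, Finset.mem_univ, true_and, not_exists,
      not_and, not_lt] at hb
    have hbT : b ∉ T := fun h => by
      have := hb b h
      rw [signCorr_self, abs_of_nonneg (by positivity)] at this
      have : (0 : ℝ) < m := by positivity
      nlinarith
    have hins : P (insert b T) := by
      intro x hx z hz hxz
      rcases Finset.mem_insert.1 hx with rfl | hx'
      · rcases Finset.mem_insert.1 hz with rfl | hz'
        · exact absurd rfl hxz
        · rw [signCorr_comm]; exact hb z hz'
      · rcases Finset.mem_insert.1 hz with rfl | hz'
        · exact hb x hx'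
        · exact hP x hx' z hz' hxz
    have := hmax (insert b T) (by simp [hins])
    rw [Finset.card_insert_of_notMem hbT] at this
    omega
  have h1 : (2 : ℝ) ^ m ≤ T.card * (2 * 2 ^ m * Real.exp (-(m * μ ^ 2 / 2))) := by
    have hc := (Finset.card_le_card hcover).trans Finset.card_biUnion_le
    have hc' : (2 : ℝ) ^ m ≤ ∑ a ∈ T, ((Finset.univ.filter fun b =>
        μ * m < |signCorr a b|).card : ℝ) := by
      have : ((Finset.univ : Finset (Fin m → Bool)).card : ℝ) = 2 ^ m := by simp
      rw [← this]
      exact_mod_cast hc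
    refine hc'.trans ((Finset.sum_le_sum fun a _ => card_lt_abs_signCorr_le a hμ).trans ?_)
    simp
  rw [Real.exp_neg] at h1
  have hexp := Real.exp_pos (m * μ ^ 2 / 2)
  have h2 : (2 : ℝ) ^ m * Real.exp (m * μ ^ 2 / 2) ≤ 2 ^ m * (2 * T.card) := by
    calc (2 : ℝ) ^ m * Real.exp (m * μ ^ 2 / 2)
        ≤ T.card * (2 * 2 ^ m * (Real.exp (m * μ ^ 2 / 2))⁻¹) * Real.exp (m * μ ^ 2 / 2) := by
          gcongr
      _ = _ := by field_simp
  exact le_of_mul_le_mul_left h2 (by positivity)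

end Signs

/-! ### The hidden-sign class and its query bound. -/

section SignClass

variable {k m : ℕ}

/-- The perturbations `D / m * ⟨θ, a⟩` for actions indexed by sign vectors. -/
def signPerturb (D : ℝ) (e : Fin k ≃ (Fin m → Bool)) (θ : Fin m → Bool) (a : Fin k) : ℝ :=
  D * (signCorr θ (e a) / m)

lemma abs_signPerturb_le {D : ℝ} (hD : 0 ≤ D) (e : Fin k ≃ (Fin m → Bool)) (θ : Fin m → Bool)
    (a : Fin k) : |signPerturb D e θ a| ≤ D := by
  rw [signPerturb, abs_mul, abs_of_nonneg hD, abs_div, Nat.abs_cast]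
  exact mul_le_of_le_one_right hD (div_le_one_of_le₀ (abs_signCorr_le _ _) (by positivity))

lemma signPerturb_symm (hm : 0 < m) (D : ℝ) (e : Fin k ≃ (Fin m → Bool)) (θ : Fin m → Bool) :
    signPerturb D e θ (e.symm θ) = D := by
  have : (m : ℝ) ≠ 0 := by positivity
  rw [signPerturb, Equiv.apply_symm_apply, signCorr_self, div_self this, mul_one]

/-- The policies whose mean action has the wrong sign in the coordinate `i`. -/
def wrongSign (e : Fin k ≃ (Fin m → Bool)) (θ : Fin m → Bool) (i : Fin m) :
    Set (Policy (Fin 2) (Fin k)) :=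
  {π | ¬ (0 ≤ policyMean (fun a => boolSign (e a i)) π ↔ θ i = true)}

lemma measurable_policyMean (y : Fin k → ℝ) : Measurable (policyMean y) := by
  unfold policyMean
  refine Finset.measurable_sum _ fun a _ => Measurable.mul_const ?_ _
  exact (measurable_pi_apply a).comp (measurable_subtype_coe.comp (measurable_pi_apply 0))

lemma measurableSet_wrongSign (e : Fin k ≃ (Fin m → Bool)) (θ : Fin m → Bool) (i : Fin m) :
    MeasurableSet (wrongSign e θ i) := by
  have h : MeasurableSet {π | 0 ≤ policyMean (fun a => boolSign (e a i)) π} :=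
    measurableSet_le measurable_const (measurable_policyMean _)
  unfold wrongSign
  cases θ i
  · simpa only [Bool.false_eq_true, iff_false, not_not] using h
  · simpa only [iff_true, Set.compl_ofPred] using h.compl

/-- The convention that a zero mean counts as a positive guess makes every policy guess exactly one
sign. -/
lemma wrongSign_update (e : Fin k ≃ (Fin m → Bool)) (θ : Fin m → Bool) (i : Fin m) :
    wrongSign e (Function.update θ i (!θ i)) i = (wrongSign e θ i)ᶜ := by
  ext π
  simp only [wrongSign, Set.mem_ofPred_eq, Set.mem_compl_iff, Function.update_self]
  cases θ i <;> simp

/-- The loss is `D / m` times the sum of `1 - boolSign (θ i) * z i`, where `z i ∈ [-1, 1]` is the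
mean of the `i`-th sign under `π`. Each term is nonnegative, and at least `1` if the guess is wrong.
-/
lemma sum_wrongSign_le {D : ℝ} (hm : 0 < m) (hD : 0 ≤ D) (e : Fin k ≃ (Fin m → Bool))
    (θ : Fin m → Bool) (π : Policy (Fin 2) (Fin k)) :
    D / m * ∑ i, (wrongSign e θ i).indicator (1 : Policy (Fin 2) (Fin k) → ℝ) π ≤
      D - policyMean (signPerturb D e θ) π := by
  have hm' : (m : ℝ) ≠ 0 := by positivity
  have hmean : policyMean (signPerturb D e θ) π =
      D / m * ∑ i, boolSign (θ i) * policyMean (fun a => boolSign (e a i)) π := by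
    simp only [policyMean, signPerturb, signCorr, Finset.mul_sum, Finset.sum_div]
    rw [Finset.sum_comm]
    refine Finset.sum_congr rfl fun i _ => Finset.sum_congr rfl fun a _ => ?_
    ring
  have hD' : D = D / m * ∑ _i : Fin m, (1 : ℝ) := by
    simp [hm']
  rw [hmean]
  nth_rewrite 2 [hD']
  rw [← mul_sub, ← Finset.sum_sub_distrib]
  refine mul_le_mul_of_nonneg_left (Finset.sum_le_sum fun i _ => ?_) (by positivity)
  have h1 : policyMean (fun a => boolSign (e a i)) π ≤ 1 :=
    policyMean_le (fun a => (abs_le.1 (abs_boolSign _).le).2) π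
  have h2 : -1 ≤ policyMean (fun a => boolSign (e a i)) π := by
    have := policyMean_le (fun a => neg_le.1 (abs_le.1 (abs_boolSign (e a i)).le).1) π
    simp only [policyMean, mul_neg, Finset.sum_neg_distrib] at this ⊢
    linarith
  simp only [Set.indicator_apply, wrongSign, Set.mem_ofPred_eq, Pi.one_apply]
  generalize policyMean (fun a => boolSign (e a i)) π = z at h1 h2 ⊢
  cases hθ : θ i
  · simp only [boolSign, Bool.false_eq_true, iff_false, not_not, if_false]
    split_ifs with h <;> linarith
  · simp only [boolSign, iff_true, if_true]
    split_ifs with h <;> linarith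

/-- The class of the two-state MDPs with perturbations `D / m * ⟨θ, a⟩`. -/
def signClass (γ D : ℝ) (e : Fin k ≃ (Fin m → Bool)) : Set (MDP (Fin 2) (Fin k)) :=
  Set.range fun θ => perturbed γ (signPerturb D e θ)

/-- The sign test with `n = ⌊N / q⌋₊`. The parameter `ρ` is the tolerated fraction of wrong signs,
`q` bounds the probability of more than `n` queries, and `0.92 = 1 - 0.08` comes from the worst
admissible `δ`. -/
lemma sq_le_of_isSound_signClass {γ α δ D ρ q N : ℝ} (hγ : 7 / 12 ≤ γ) (hγ1 : γ < 1)
    (hα : 0 < α) (hα' : α * (1 - γ) ≤ 1 / 80) (hδ : 0 < δ) (hδ' : δ ≤ 0.08)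
    (hD : 4 * α * (1 - γ) ^ 2 ≤ D) (hDγ : D ≤ (1 - γ) / 5) (hm : 0 < m)
    (hρ0 : 0 ≤ ρ) (hρ : ∀ j : ℕ, ρ * m < j → 4 * α * (1 - γ) ^ 2 ≤ D / m * j)
    (hq : 0 < q) (hqρ : q + ρ ≤ 0.92)
    (e : Fin k ≃ (Fin m → Bool)) (p : Planner (Fin 2) (Fin k))
    (hp : p.IsSound (signClass γ D e) γ 0 α δ) (hN : 0 ≤ N)
    (hpN : p.queryComplexity (signClass γ D e) ≤ ENNReal.ofReal N) :
    (0.92 - q - ρ) ^ 2 ≤ Real.exp (60 * D ^ 2 / (m ^ 2 * (1 - γ)) * (N / q)) * (0.08 + ρ) := by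
  have hg0 : 0 < 1 - γ := by linarith
  have hD0 : 0 ≤ D := le_trans (by positivity) hD
  have hmem : ∀ θ, perturbed γ (signPerturb D e θ) ∈ signClass γ D e := fun θ => ⟨θ, rfl⟩
  have hy : ∀ θ a, |signPerturb D e θ a| ≤ (1 - γ) / 5 := fun θ a =>
    (abs_signPerturb_le hD0 e θ a).trans hDγ
  set C : ℝ := 1 + 15 * (2 * D / m) ^ 2 / (1 - γ) with hC
  have hC1 : 1 ≤ C := by
    have : 0 ≤ 15 * (2 * D / m) ^ 2 / (1 - γ) := by positivity
    linarith
  set n := ⌊N / q⌋₊ with hn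
  have hn1 : N ≤ q * (n + 1) := by
    have := Nat.lt_floor_add_one (N / q)
    rw [div_lt_iff₀ hq] at this
    linarith
  have key := p.sq_le_of_sign_test hm (fun θ => perturbed γ (signPerturb D e θ)) hC1
    (fun θ i => perturbed_sq_lintegral_le hγ hγ1 (hy θ) (hy _) fun a => by
      rw [signPerturb, signPerturb, ← mul_sub, ← sub_div, abs_mul, abs_of_nonneg hD0, abs_div,
        Nat.abs_cast]
      calc D * (|signCorr θ (e a) - signCorr (Function.update θ i (!θ i)) (e a)| / m)
          ≤ D * (2 / m) := by gcongr; exact abs_signCorr_sub_update_le _ _ _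
        _ = 2 * D / m := by ring)
    (wrongSign e) (measurableSet_wrongSign e) (wrongSign_update e) (δ := 0.08) (ρ := ρ) hN hn1
    (by linarith) (fun θ => (hp _ (hmem θ)).1)
    (fun θ => by
      refine le_trans ((hp _ (hmem θ)).runLaw_le hδ.le (by linarith) ?_ ?_)
        (ENNReal.ofReal_le_ofReal hδ')
      · exact measurableSet_lt measurable_const (Finset.measurable_sum _ fun i _ =>
          measurable_outcome fun k => (measurable_one.indicator
            (measurableSet_wrongSign e θ i)).comp measurable_snd)
      · intro x hx
        by_contra h
        have hlt := sub_policyMean_lt hγ hγ1 hα hα' hD (hy θ)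
          (fun a => (abs_le.1 (abs_signPerturb_le hD0 e θ a)).2) (signPerturb_symm hm D e θ)
          (not_lt.1 h)
        have hsum := sum_wrongSign_le hm hD0 e θ x.2.2
        -- Integrality of the number of wrong signs permits `ρ = 0`, where a single wrong sign must
        -- already exceed the loss allowed.
        have hcard : ∃ j : ℕ, ∑ i, (wrongSign e θ i).indicator
            (1 : Policy (Fin 2) (Fin k) → ℝ) x.2.2 = j := by
          classical
          exact ⟨(Finset.univ.filter fun i => x.2.2 ∈ wrongSign e θ i).card, by
            simp [Set.indicator_apply]⟩
        obtain ⟨j, hj⟩ := hcard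
        rw [Set.mem_ofPred_eq, hj] at hx
        rw [hj] at hsum
        linarith [hρ j hx])
    (by norm_num) hρ0
    (fun θ => (p.lintegral_le_queryComplexity (hmem θ)).trans hpN)
  have hCexp : C ^ n ≤ Real.exp (60 * D ^ 2 / (m ^ 2 * (1 - γ)) * (N / q)) := by
    have h1 : C ≤ Real.exp (60 * D ^ 2 / (m ^ 2 * (1 - γ))) := by
      have : C = 60 * D ^ 2 / (m ^ 2 * (1 - γ)) + 1 := by rw [hC]; field_simp; ring
      rw [this]
      exact Real.add_one_le_exp _
    calc C ^ n ≤ Real.exp (60 * D ^ 2 / (m ^ 2 * (1 - γ))) ^ n := by gcongr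
      _ = Real.exp (n * (60 * D ^ 2 / (m ^ 2 * (1 - γ)))) := (Real.exp_nat_mul _ _).symm
      _ ≤ _ := by
        rw [mul_comm]
        refine Real.exp_le_exp.2 (mul_le_mul_of_nonneg_left (Nat.floor_le (by positivity))
          (by positivity))
  calc (0.92 - q - ρ) ^ 2 = (1 - q - 0.08 - ρ) ^ 2 := by ring
    _ ≤ C ^ n * (0.08 + ρ) := key
    _ ≤ _ := by gcongr

end SignClass

/-! ### Linearity and exact realizability of the hidden-sign class. -/

section LinearClass

variable {k m m' : ℕ}

lemma signClass_isLinear_and_approxError {γ D : ℝ} (hγ : 7 / 12 ≤ γ) (hγ1 : γ < 1) (hD0 : 0 ≤ D)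
    (hDγ : D ≤ (1 - γ) / 5) (e : Fin k ≃ (Fin m' → Bool))
    (U : (Fin m' → Bool) → EuclideanSpace ℝ (Fin m)) (hU : ∀ a, ‖U a‖ = 1)
    (hinner : ∀ a b, inner ℝ (U a) (U b) = signCorr b a / m') :
    ∀ M ∈ signClass γ D e, M.IsLinear (blockFeature fun a => U (e a)) 2 (2 / (1 - γ)) ∧
      M.approxError γ (blockFeature fun a => U (e a)) (2 / (1 - γ)) = 0 := by
  rintro _ ⟨θ, rfl⟩
  have hy : ∀ a, |signPerturb D e θ a| ≤ (1 - γ) / 5 := fun a =>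
    (abs_signPerturb_le hD0 e θ a).trans hDγ
  have hw : ‖D • U θ‖ ≤ (1 - γ) / 5 := by
    rwa [norm_smul, hU, mul_one, Real.norm_of_nonneg hD0]
  have hyw : ∀ a, signPerturb D e θ a = inner ℝ (U (e a)) (D • U θ) := fun a => by
    rw [inner_smul_right, hinner, signPerturb]
  refine ⟨perturbed_isLinear hγ hγ1 hy (fun a => (hU _).le) hw hyw, ?_⟩
  have := perturbed_approxError_le (η := 0) (ε := 0) hγ hγ1 hy (U := fun a => U (e a)) hw
    (fun a => by rw [hyw, sub_self, abs_zero]) (by simp)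
  simpa using this

/-- Repeating one sign in all coordinates embeds the one-sign problem in any positive dimension `m`.
-/
lemma inner_signVec_const (a b : Fin 1 → Bool) (hm : 0 < m) :
    inner ℝ (signVec fun _ : Fin m => a 0) (signVec fun _ : Fin m => b 0) =
      signCorr b a / (1 : ℕ) := by
  have : (m : ℝ) ≠ 0 := by positivity
  rw [inner_signVec]
  simp [signCorr]
  field_simp

end LinearClass

/-! ### The hard classes and the final constants. -/

section Bounds

/-- By `4 * γ ≤ (1 + γ) ^ 2`. The value `1 / 80` is what makes `D = 16 * α * (1 - γ) ^ 2` at most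
`(1 - γ) / 5`. -/
lemma mul_one_sub_le {γ α : ℝ} (hγ : 7 / 12 ≤ γ) (hγ1 : γ < 1)
    (hα : α ≤ 0.05 * γ / ((1 - γ) * (1 + γ) ^ 2)) : α * (1 - γ) ≤ 1 / 80 := by
  have hg0 : 0 < 1 - γ := by linarith
  rw [le_div_iff₀ (by positivity)] at hα
  have h : 0 < (1 + γ) ^ 2 := by positivity
  have : α * (1 - γ) * (1 + γ) ^ 2 ≤ 1 / 80 * (1 + γ) ^ 2 := by
    nlinarith [sq_nonneg (1 - γ)]
  exact le_of_mul_le_mul_right this h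

variable {m : ℕ} {γ α δ : ℝ}

/-- The linear MDPs that are hard for the accuracy `α`. -/
lemma exists_linear_class (hm : 0 < m) (hγ : 7 / 12 ≤ γ) (hγ1 : γ < 1) (hα : 0 < α)
    (hα' : α * (1 - γ) ≤ 1 / 80) (hδ : 0 < δ) (hδ' : δ ≤ 0.08) :
    ∃ (k : ℕ) (_ : 1 ≤ k) (s₀ : Fin 2) (φ : Fin 2 → Fin k → EuclideanSpace ℝ (Fin (m + 2)))
      (𝓜 : Set (MDP (Fin 2) (Fin k))), (∀ s a, ‖φ s a‖ ≤ 2) ∧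
      (∀ M ∈ 𝓜, M.IsLinear φ 2 (2 / (1 - γ)) ∧ M.approxError γ φ (2 / (1 - γ)) = 0) ∧
      ∀ p : Planner (Fin 2) (Fin k), p.IsSound 𝓜 γ s₀ α δ →
        ENNReal.ofReal (1 / 10 ^ 8 * (((m + 2 : ℕ) : ℝ) ^ 2 / (α ^ 2 * (1 - γ) ^ 3))) ≤
          p.queryComplexity 𝓜 := by
  have hg0 : 0 < 1 - γ := by linarith
  have hmR : (1 : ℝ) ≤ m := by exact_mod_cast hm
  let e : Fin (2 ^ m) ≃ (Fin m → Bool) := (Fintype.equivFinOfCardEq (by simp)).symm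
  set D : ℝ := 16 * α * (1 - γ) ^ 2 with hD
  have hD0 : 0 ≤ D := by positivity
  have hDγ : D ≤ (1 - γ) / 5 := by
    rw [hD]; nlinarith
  refine ⟨2 ^ m, Nat.one_le_two_pow, 0, blockFeature fun a => signVec (e a), signClass γ D e,
    norm_blockFeature_le fun a => (norm_signVec hm _).le,
    signClass_isLinear_and_approxError hγ hγ1 hD0 hDγ e signVec (norm_signVec hm)
      (fun a b => by rw [inner_signVec, signCorr_comm]), fun p hp => ?_⟩
  rcases eq_or_ne (p.queryComplexity (signClass γ D e)) ⊤ with htop | htop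
  · rw [htop]; exact le_top
  set N := (p.queryComplexity (signClass γ D e)).toReal with hN
  have hNc : ENNReal.ofReal N = p.queryComplexity (signClass γ D e) := ENNReal.ofReal_toReal htop
  rw [← hNc]
  refine ENNReal.ofReal_le_ofReal ?_
  -- With this `D`, more than `m / 4` wrong signs lose at least `D / 4 = 4 * α * (1 - γ) ^ 2`. The
  -- resulting inequality is `0.62 ^ 2 ≤ exp X * 0.33`, which fails for `X < 1 / 10`.
  have key := sq_le_of_isSound_signClass (ρ := 1 / 4) (q := 1 / 20) hγ hγ1 hα hα' hδ hδ'
    (by rw [hD]; nlinarith [mul_pos hα (pow_pos hg0 2)]) hDγ hm (by norm_num)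
    (fun j hj => by
      rw [hD, div_mul_eq_mul_div, le_div_iff₀ (by positivity)]
      nlinarith [mul_pos hα (pow_pos hg0 2)])
    (by norm_num) (by norm_num) e p hp ENNReal.toReal_nonneg hNc.ge
  set X := 60 * D ^ 2 / (m ^ 2 * (1 - γ)) * (N / (1 / 20)) with hX
  have hX1 : 1 / 10 ≤ X := by
    by_contra h
    have hlt : X < 1 / 10 := not_le.1 h
    have h1 : 1 - X ≤ Real.exp (-X) := by linarith [Real.add_one_le_exp (-X)]
    have h2 : Real.exp (-X) * Real.exp X = 1 := by rw [← Real.exp_add]; simp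
    have h3 := Real.exp_pos X
    norm_num at key
    nlinarith
  have hXe : X = 307200 * (α ^ 2 * (1 - γ) ^ 3) * N / m ^ 2 := by
    rw [hX, hD]; field_simp; ring
  rw [hXe, le_div_iff₀ (by positivity)] at hX1
  rw [← mul_div_assoc, div_le_iff₀ (by positivity)]
  push_cast
  have : ((m : ℝ) + 2) ^ 2 ≤ 9 * m ^ 2 := by nlinarith
  nlinarith

/-- Testing one sign takes at least two queries. -/
lemma exists_two_query_class (hm : 0 < m) (hγ : 7 / 12 ≤ γ) (hγ1 : γ < 1) (hα : 0 < α)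
    (hα' : α * (1 - γ) ≤ 1 / 80) (hδ : 0 < δ) (hδ' : δ ≤ 0.08) :
    ∃ (k : ℕ) (_ : 1 ≤ k) (s₀ : Fin 2) (φ : Fin 2 → Fin k → EuclideanSpace ℝ (Fin (m + 2)))
      (𝓜 : Set (MDP (Fin 2) (Fin k))), (∀ s a, ‖φ s a‖ ≤ 2) ∧
      (∀ M ∈ 𝓜, M.approxError γ φ (2 / (1 - γ)) = 0) ∧
      ∀ p : Planner (Fin 2) (Fin k), p.IsSound 𝓜 γ s₀ α δ → 2 ≤ p.queryComplexity 𝓜 := by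
  have hg0 : 0 < 1 - γ := by linarith
  let e : Fin 2 ≃ (Fin 1 → Bool) := (Fintype.equivFinOfCardEq (by simp)).symm
  set D : ℝ := 4 * α * (1 - γ) ^ 2 with hD
  have hD0 : 0 ≤ D := by positivity
  have hDγ' : D ≤ (1 - γ) / 20 := by
    rw [hD]; nlinarith
  have hDγ : D ≤ (1 - γ) / 5 := by linarith
  refine ⟨2, by norm_num, 0, blockFeature fun a => signVec fun _ : Fin m => e a 0,
    signClass γ D e, norm_blockFeature_le fun a => (norm_signVec hm _).le,
    fun M hM => (signClass_isLinear_and_approxError hγ hγ1 hD0 hDγ e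
      (fun a => signVec fun _ : Fin m => a 0) (fun a => norm_signVec hm _)
      (fun a b => inner_signVec_const a b hm) M hM).2, fun p hp => ?_⟩
  rcases eq_or_ne (p.queryComplexity (signClass γ D e)) ⊤ with htop | htop
  · rw [htop]; exact le_top
  set N := (p.queryComplexity (signClass γ D e)).toReal with hN
  have hNc : ENNReal.ofReal N = p.queryComplexity (signClass γ D e) := ENNReal.ofReal_toReal htop
  have hN0 : 0 ≤ N := ENNReal.toReal_nonneg
  -- Here the test gives `0.82 ^ 2 ≤ exp X * 0.08`, hence `exp X > 8`; but `N < 2` would give `X ≤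
  -- 2` and `exp X ≤ 8`.
  have key := sq_le_of_isSound_signClass (ρ := 0) (q := 1 / 10) hγ hγ1 hα hα' hδ hδ'
    hD.ge hDγ one_pos le_rfl
    (fun j hj => by
      have hj' : (1 : ℝ) ≤ j := by
        have : 0 < j := by exact_mod_cast (by simpa using hj : (0 : ℝ) < j)
        exact_mod_cast this
      rw [← hD, Nat.cast_one, div_one]
      exact le_mul_of_one_le_right hD0 hj')
    (by norm_num) (by norm_num) e p hp hN0 hNc.ge
  rw [← hNc, ← ENNReal.ofReal_ofNat]
  refine ENNReal.ofReal_le_ofReal ?_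
  by_contra h
  have hlt : N < 2 := not_le.1 h
  have hX : 60 * D ^ 2 / (((1 : ℕ) : ℝ) ^ 2 * (1 - γ)) * (N / (1 / 10)) ≤ 2 := by
    have h1 : 60 * D ^ 2 / (((1 : ℕ) : ℝ) ^ 2 * (1 - γ)) ≤ 1 / 10 := by
      rw [Nat.cast_one, one_pow, one_mul, div_le_iff₀ hg0]
      have : D ^ 2 ≤ ((1 - γ) / 20) ^ 2 := by gcongr
      nlinarith
    calc _ ≤ 1 / 10 * (N / (1 / 10)) := by gcongr
      _ ≤ 2 := by linarith
  have hexp : Real.exp 2 ≤ 8 := by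
    have : Real.exp 2 = Real.exp 1 * Real.exp 1 := by rw [← Real.exp_add]; norm_num
    rw [this]
    nlinarith [Real.exp_one_lt_d9, Real.exp_pos 1]
  have := (Real.exp_le_exp.2 hX).trans hexp
  norm_num at key this
  linarith

/-- The MDP in which the action `a` stays in state `0` with a larger probability than the others. -/
def needle {k : ℕ} (γ D : ℝ) (a : Fin k) : MDP (Fin 2) (Fin k) := perturbed γ (Pi.single a D)

/-- The reference MDP has no spike, and the others raise one action by `D`. As `4 * α * (1 - γ) ^ 2
= D / 4`, a nearly optimal policy puts more than half of its mass on the spiked action, and these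
events are disjoint. The factor `0.92` is `1 - 0.08`. -/
lemma exists_needle_class {K : ℕ} (hγ : 7 / 12 ≤ γ) (hγ1 : γ < 1) (hα : 0 < α)
    (hα' : α * (1 - γ) ≤ 1 / 80) (hδ : 0 < δ) (hδ' : δ ≤ 0.08) {ε : ℝ} (hε : 0 ≤ ε)
    (U : Fin K → EuclideanSpace ℝ (Fin m)) (hU : ∀ a, ‖U a‖ ≤ 1)
    (hUU : ∀ a, ∃ w : EuclideanSpace ℝ (Fin m), ‖w‖ ≤ (1 - γ) / 5 ∧ ∀ b,
      |(Pi.single a (16 * α * (1 - γ) ^ 2) : Fin K → ℝ) b - inner ℝ (U b) w| ≤ ε * (1 - γ)) :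
    ∃ 𝓜 : Set (MDP (Fin 2) (Fin K)), (∀ s a, ‖blockFeature U s a‖ ≤ 2) ∧
      (∀ M ∈ 𝓜, M.approxError γ (blockFeature U) (2 / (1 - γ)) ≤ ENNReal.ofReal ε) ∧
      ∀ p : Planner (Fin 2) (Fin K), p.IsSound 𝓜 γ 0 α δ →
        ENNReal.ofReal (0.92 * K - 1) ≤ p.queryComplexity 𝓜 := by
  have hg0 : 0 < 1 - γ := by linarith
  set D : ℝ := 16 * α * (1 - γ) ^ 2 with hD
  have hD0 : 0 < D := by positivity
  have hDγ : D ≤ (1 - γ) / 5 := by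
    rw [hD]; nlinarith
  have hy : ∀ a b : Fin K, |(Pi.single a D : Fin K → ℝ) b| ≤ (1 - γ) / 5 := fun a b => by
    rcases eq_or_ne b a with rfl | hab
    · rwa [Pi.single_eq_same, abs_of_pos hD0]
    · rw [Pi.single_eq_of_ne hab, abs_zero]; positivity
  refine ⟨insert (perturbed γ 0) (Set.range (needle γ D)), norm_blockFeature_le hU, ?_, ?_⟩
  · rintro M (rfl | ⟨a, rfl⟩)
    · exact perturbed_approxError_le (η := 0) (w := 0) hγ hγ1
        (fun a => by rw [Pi.zero_apply, abs_zero]; positivity) (by rw [norm_zero]; positivity)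
        (by simp) (by positivity)
    · obtain ⟨w, hw, hη⟩ := hUU a
      exact perturbed_approxError_le hγ hγ1 (hy a) hw hη le_rfl
  · intro p hp
    set 𝓜 : Set (MDP (Fin 2) (Fin K)) := insert (perturbed γ 0) (Set.range (needle γ D))
    have hmean : ∀ (a : Fin K) (π : Policy (Fin 2) (Fin K)),
        policyMean (Pi.single a D) π = (π 0 : Fin K → ℝ) a * D := fun a π => by
      simp [policyMean, Pi.single_apply]
    let G : Fin K → Set (Policy (Fin 2) (Fin K)) := fun a =>
      {π | 1 / 2 * D < policyMean (Pi.single a D) π}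
    have hG : ∀ a, MeasurableSet (G a) := fun a =>
      measurableSet_lt measurable_const (measurable_policyMean _)
    have key := p.card_le_lintegral_queries 0 (perturbed γ 0) (needle γ D) ?_ G hG ?_
      (δ := ENNReal.ofReal 0.08) (hp _ (Set.mem_insert _ _)).1 ?_
    · have h1 := key.trans (add_le_add_left (add_le_add_left
        (p.lintegral_le_queryComplexity (𝓜 := 𝓜) (Set.mem_insert _ _)) _) _)
      rcases eq_or_ne (p.queryComplexity 𝓜) ⊤ with htop | htop
      · rw [htop]; exact le_top
      set N := (p.queryComplexity 𝓜).toReal with hN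
      have hNc : ENNReal.ofReal N = p.queryComplexity 𝓜 := ENNReal.ofReal_toReal htop
      change _ ≤ p.queryComplexity 𝓜 + 1 + _ at h1
      rw [← hNc] at h1 ⊢
      refine ENNReal.ofReal_le_ofReal ?_
      have h2 := ENNReal.toReal_mono (by finiteness) h1
      rw [ENNReal.toReal_add (by finiteness) (by finiteness), ENNReal.toReal_add (by finiteness)
        (by finiteness), ENNReal.toReal_mul, ENNReal.toReal_ofReal ENNReal.toReal_nonneg,
        ENNReal.toReal_ofReal (by norm_num)] at h2
      simp only [Fintype.card_fin, ENNReal.toReal_natCast, ENNReal.toReal_one] at h2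
      linarith
    · rintro a ⟨s, b⟩ hx
      obtain rfl | rfl : s = 0 ∨ s = 1 := by omega
      · have hb : b ≠ a := fun h => hx (by rw [h])
        rw [needle, perturbed, perturbed, twoState_Q_zero, twoState_Q_zero, Pi.single_eq_of_ne hb]
        rfl
      · rfl
    · intro a b hab
      refine Set.disjoint_left.2 fun π ha hb => ?_
      simp only [G, Set.mem_ofPred_eq, hmean] at ha hb
      have ha' := lt_of_mul_lt_mul_right ha hD0.le
      have hb' := lt_of_mul_lt_mul_right hb hD0.le
      have hsum : (π 0 : Fin K → ℝ) a + (π 0 : Fin K → ℝ) b ≤ 1 := by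
        rw [← π.sum_eq_one 0, ← Finset.sum_pair hab]
        exact Finset.sum_le_sum_of_subset_of_nonneg (Finset.subset_univ _)
          fun i _ _ => π.nonneg 0 i
      linarith
    · intro a
      refine le_trans ((hp _ (Set.mem_insert_of_mem _ ⟨a, rfl⟩)).runLaw_le hδ.le (by linarith)
        ?_ ?_) (ENNReal.ofReal_le_ofReal hδ')
      · exact measurableSet_setOfPred.2 (measurable_outcome fun n =>
          measurableSet_setOfPred.1 (measurable_snd (hG a).compl))
      · intro x hx
        by_contra h
        have hlt := sub_policyMean_lt (y := Pi.single a D) (D := D) hγ hγ1 hα hα'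
          (by rw [hD]; nlinarith [mul_pos hα (pow_pos hg0 2)]) (hy a)
          (fun b => by
            rcases eq_or_ne b a with rfl | hab
            · rw [Pi.single_eq_same]
            · rw [Pi.single_eq_of_ne hab]; exact hD0.le)
          (by simp : (Pi.single a D : Fin K → ℝ) a = D) (not_lt.1 h)
        refine hx ?_
        simp only [G, Set.mem_ofPred_eq]
        have : 4 * α * (1 - γ) ^ 2 = D / 4 := by rw [hD]; ring
        linarith

/-- With approximation error `ε` there are exponentially many actions to be searched. -/
lemma exists_exponential_class (hm : 0 < m) (hγ : 7 / 12 ≤ γ) (hγ1 : γ < 1) (hα : 0 < α)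
    (hα' : α * (1 - γ) ≤ 1 / 80) (hδ : 0 < δ) (hδ' : δ ≤ 0.08) {ε X : ℝ} (hε : 0 ≤ ε)
    (hX : X = Real.exp (1 / 10 ^ 8 * (((m + 2 : ℕ) : ℝ) * ε ^ 2 / (α ^ 2 * (1 - γ) ^ 2))))
    (hX2 : 2 ≤ X) :
    ∃ (k : ℕ) (_ : 1 ≤ k) (s₀ : Fin 2) (φ : Fin 2 → Fin k → EuclideanSpace ℝ (Fin (m + 2)))
      (𝓜 : Set (MDP (Fin 2) (Fin k))), (∀ s a, ‖φ s a‖ ≤ 2) ∧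
      (∀ M ∈ 𝓜, M.approxError γ φ (2 / (1 - γ)) ≤ ENNReal.ofReal ε) ∧
      ∀ p : Planner (Fin 2) (Fin k), p.IsSound 𝓜 γ s₀ α δ →
        ENNReal.ofReal X ≤ p.queryComplexity 𝓜 := by
  have hg0 : 0 < 1 - γ := by linarith
  have hmR : (1 : ℝ) ≤ m := by exact_mod_cast hm
  set D : ℝ := 16 * α * (1 - γ) ^ 2 with hD
  have hD0 : 0 < D := by positivity
  have hDγ : D ≤ (1 - γ) / 5 := by
    rw [hD]; nlinarith
  -- The correlation level at which `D * μ` equals the permitted misfit `ε * (1 - γ)`.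
  set μ : ℝ := ε / (16 * α * (1 - γ)) with hμ
  have hμ0 : 0 ≤ μ := by positivity
  have hDμ : D * μ = ε * (1 - γ) := by rw [hD, hμ]; field_simp
  suffices h : ∃ (K : ℕ) (U : Fin K → EuclideanSpace ℝ (Fin m)), (∀ a, ‖U a‖ ≤ 1) ∧
      (∀ a, ∃ w : EuclideanSpace ℝ (Fin m), ‖w‖ ≤ (1 - γ) / 5 ∧ ∀ b,
        |(Pi.single a D : Fin K → ℝ) b - inner ℝ (U b) w| ≤ ε * (1 - γ)) ∧ X ≤ 0.92 * K - 1 by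
    obtain ⟨K, U, hU, hUU, hK⟩ := h
    obtain ⟨𝓜, h1, h2, h3⟩ := exists_needle_class hγ hγ1 hα hα' hδ hδ' hε U hU hUU
    have hK1 : 1 ≤ K := by
      rcases Nat.eq_zero_or_pos K with rfl | h
      · norm_num at hK; linarith
      · exact h
    exact ⟨K, hK1, 0, blockFeature U, 𝓜, h1, h2, fun p hp =>
      (ENNReal.ofReal_le_ofReal hK).trans (h3 p hp)⟩
  rcases lt_or_ge μ 1 with hμ1 | hμ1
  · obtain ⟨T, hT, hcard⟩ := exists_nearly_orthogonal hm hμ0 hμ1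
    let e := T.equivFin.symm
    refine ⟨T.card, fun a => signVec (e a : Fin m → Bool), fun a => (norm_signVec hm _).le,
      fun a => ⟨D • signVec (e a : Fin m → Bool), ?_, fun b => ?_⟩, ?_⟩
    · rwa [norm_smul, norm_signVec hm, mul_one, Real.norm_of_nonneg hD0.le]
    · rw [inner_smul_right, inner_signVec]
      rcases eq_or_ne b a with rfl | hab
      · have : (m : ℝ) ≠ 0 := by positivity
        rw [Pi.single_eq_same, signCorr_self, div_self this, mul_one, sub_self, abs_zero]
        positivity
      · rw [Pi.single_eq_of_ne hab, zero_sub, abs_neg, abs_mul, abs_of_pos hD0, abs_div,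
          Nat.abs_cast, ← hDμ]
        refine mul_le_mul_of_nonneg_left ?_ hD0.le
        rw [div_le_iff₀ (by positivity)]
        exact hT _ (e b).2 _ (e a).2 fun h => hab (e.injective (Subtype.ext h))
    -- The small constant in the exponent leaves room for a fourth power. With `X ≥ 2` this gives `8
    -- * X ≤ X ^ 4 ≤ 2 * T.card`, which absorbs the factors lost.
    · have hXexp : X ^ 4 ≤ Real.exp (m * μ ^ 2 / 2) := by
        rw [hX, ← Real.exp_nat_mul]
        refine Real.exp_le_exp.2 ?_
        have : ((m + 2 : ℕ) : ℝ) * ε ^ 2 / (α ^ 2 * (1 - γ) ^ 2) = 256 * ((m + 2) * μ ^ 2) := by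
          rw [hμ]; push_cast; field_simp; ring
        rw [this]
        push_cast
        nlinarith [sq_nonneg μ]
      have h4 : 8 * X ≤ X ^ 4 := by
        have : 2 ^ 3 ≤ X ^ 3 := by gcongr
        nlinarith
      linarith
  -- For `μ ≥ 1` the spike itself is within the permitted misfit, so zero features do and the number
  -- of actions is unrestricted.
  · refine ⟨⌈2 * X⌉₊ + 2, 0, by simp, fun a => ⟨0, by rw [norm_zero]; positivity, fun b => ?_⟩, ?_⟩
    · rw [inner_zero_right, sub_zero, ← hDμ]
      rcases eq_or_ne b a with rfl | hab
      · rw [Pi.single_eq_same, abs_of_pos hD0]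
        exact le_mul_of_one_le_right hD0.le hμ1
      · rw [Pi.single_eq_of_ne hab, abs_zero]; positivity
    · have := Nat.le_ceil (2 * X)
      push_cast
      linarith

end Bounds

end Planning
end

theorem theorem3 :
    ∃ c : ℝ, 0 < c ∧
    -- the lower bound for classes with approximation error at most `ε`
    (∀ (γ α δ ε : ℝ) (d : ℕ), 7 / 12 ≤ γ → γ < 1 →
      0 < α → α < 0.05 * γ / ((1 - γ) * (1 + γ) ^ 2) → 0 < δ → δ ≤ 0.08 → 3 ≤ d → 0 ≤ ε →
      ∃ (k : ℕ) (_ : 1 ≤ k) (s₀ : Fin 2) (φ : Fin 2 → Fin k → EuclideanSpace ℝ (Fin d))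
        (𝓜 : Set (Planning.MDP (Fin 2) (Fin k))),
        (∀ s a, ‖φ s a‖ ≤ 2) ∧
        (∀ M ∈ 𝓜, M.approxError γ φ (2 / (1 - γ)) ≤ ENNReal.ofReal ε) ∧
        ∀ p : Planning.Planner (Fin 2) (Fin k), p.IsSound 𝓜 γ s₀ α δ →
          ENNReal.ofReal (max (Real.exp (c * (d * ε ^ 2 / (α ^ 2 * (1 - γ) ^ 2))))
            (c * (d ^ 2 / (α ^ 2 * (1 - γ) ^ 3)))) ≤ p.queryComplexity 𝓜) ∧
    -- the second term for two-state linear MDPs with approximation error zero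
    (∀ (γ α δ : ℝ) (d : ℕ), 7 / 12 ≤ γ → γ < 1 →
      0 < α → α ≤ 0.05 * γ / ((1 - γ) * (1 + γ) ^ 2) → 0 < δ → δ ≤ 0.08 → 3 ≤ d →
      ∃ (k : ℕ) (_ : 1 ≤ k) (s₀ : Fin 2) (φ : Fin 2 → Fin k → EuclideanSpace ℝ (Fin d))
        (𝓜 : Set (Planning.MDP (Fin 2) (Fin k))),
        (∀ M ∈ 𝓜, M.IsLinear φ 2 (2 / (1 - γ)) ∧ M.approxError γ φ (2 / (1 - γ)) = 0) ∧
        ∀ p : Planning.Planner (Fin 2) (Fin k), p.IsSound 𝓜 γ s₀ α δ →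
          ENNReal.ofReal (c * (d ^ 2 / (α ^ 2 * (1 - γ) ^ 3))) ≤ p.queryComplexity 𝓜) := by
  refine ⟨1 / 10 ^ 8, by norm_num, ?_, ?_⟩
  · intro γ α δ ε d hγ hγ1 hα hα1 hδ hδ' hd hε
    obtain ⟨m, rfl⟩ : ∃ m, d = m + 2 := ⟨d - 2, by omega⟩
    have hm : 0 < m := by omega
    have hα' := Planning.mul_one_sub_le hγ hγ1 hα1.le
    rcases le_total (Real.exp (1 / 10 ^ 8 * ((m + 2 : ℕ) * ε ^ 2 / (α ^ 2 * (1 - γ) ^ 2))))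
      (1 / 10 ^ 8 * ((m + 2 : ℕ) ^ 2 / (α ^ 2 * (1 - γ) ^ 3))) with h | h
    · obtain ⟨k, hk, s₀, φ, 𝓜, h1, h2, h3⟩ :=
        Planning.exists_linear_class hm hγ hγ1 hα hα' hδ hδ'
      refine ⟨k, hk, s₀, φ, 𝓜, h1, fun M hM => (h2 M hM).2.le.trans zero_le, fun p hp => ?_⟩
      rw [max_eq_right h]
      exact h3 p hp
    · rw [max_eq_left h]
      -- The packing bound is too weak when the exponential is near `1`; there two queries already
      -- suffice for the bound.
      rcases le_total (Real.exp (1 / 10 ^ 8 * ((m + 2 : ℕ) * ε ^ 2 / (α ^ 2 * (1 - γ) ^ 2)))) 2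
        with hX | hX
      · obtain ⟨k, hk, s₀, φ, 𝓜, h1, h2, h3⟩ :=
          Planning.exists_two_query_class hm hγ hγ1 hα hα' hδ hδ'
        refine ⟨k, hk, s₀, φ, 𝓜, h1, fun M hM => (h2 M hM).le.trans zero_le, fun p hp => ?_⟩
        refine (ENNReal.ofReal_le_ofReal hX).trans ?_
        rw [ENNReal.ofReal_ofNat]
        exact h3 p hp
      · exact Planning.exists_exponential_class hm hγ hγ1 hα hα' hδ hδ' hε rfl hX
  · intro γ α δ d hγ hγ1 hα hα1 hδ hδ' hd
    obtain ⟨m, rfl⟩ : ∃ m, d = m + 2 := ⟨d - 2, by omega⟩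
    have hm : 0 < m := by omega
    obtain ⟨k, hk, s₀, φ, 𝓜, _, h2, h3⟩ :=
      Planning.exists_linear_class hm hγ hγ1 hα (Planning.mul_one_sub_le hγ hγ1 hα1) hδ hδ'
    exact ⟨k, hk, s₀, φ, 𝓜, h2, h3⟩
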